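/- Let $n,p\ge 0$ be integers. Let $\operatorname{Gr}_{n,p}=\{P\in\mathbb R^{n\times n}: P^T=P=P^2,\ \operatorname{rank}P=p\}$ be the Grassmannian in the projector perspective, with the canonical metric $g_P(\Delta_1,\Delta_2)=\tfrac12\operatorname{Tr}\big([\Delta_1,P]^T[\Delta_2,P]\big)$ (half the trace inner product of the horizontal lifts $[\Delta_i,P]O$ to an orthogonal matrix $O$ over $P$). Let $\widetilde{\operatorname{Gr}}_{n,p}=\{U\in\mathbb R^{n\times p}:U^TU=I_p\}/O(p)$ be the Grassmannian in the ONB perspective, where $U\sim UR$ for $R\in O(p)$; its tangent vectors at the class of $U$ are represented by their horizontal lifts $D$ at $U$ (that is, $U^TD=0$), with the canonical metric $\tilde g_U(D_1,D_2)=\operatorname{Tr}\big(D_1^T(I_n-\tfrac12UU^T)D_2\big)$. In either space the Riemannian logarithm of a point $y$ at a point $x$ is the initial velocity of the minimizing geodesic on $[0,1]$ from $x$ to $y$ (a $C^1$ curve of constant speed and of least length among the $C^1$ curves from $x$ to $y$); it is defined when this geodesic is unique. Write $\operatorname{Log}^{gr}_P(Q)$ for the logarithm in the projector perspective, and $\widetilde{\operatorname{Log}}^{gr}_U(V)$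 for the horizontal lift at $U$ of the logarithm, in the ONB perspective, of the class of $V$ at the class of $U$. Let $\tau(U)=UU^T$. Then $\tau$ induces a bijection from $\widetilde{\operatorname{Gr}}_{n,p}$ onto $\operatorname{Gr}_{n,p}$. Let $P,Q\in\operatorname{Gr}_{n,p}$, and let $U=\tau^{-1}(P)$ and $V=\tau^{-1}(Q)$, that is, let $U,V$ be any matrices with orthonormal columns such that $UU^T=P$ and $VV^T=Q$. Then $\operatorname{Log}^{gr}_P(Q)$ is defined if and only if $L=\widetilde{\operatorname{Log}}^{gr}_U(V)$ is defined, and in that case $$\operatorname{Log}^{gr}_P(Q)=U L^T+L\,U^T .$$ If $U^TV$ is invertible, then both logarithms are defined and they are given by the usual closed forms $$\operatorname{Log}^{gr}_P(Q)=[\Omega,P],\quad \Omega=\tfrac12\log\big((I_n-2Q)(I_n-2P)\big),\qquad L=W\arctan(\Sigma)Z^T,$$ where $\log$ is the principal matrix logarithm (the $X$ with $\exp X=(I_n-2Q)(I_n-2P)$ whose complex eigenvalues have imaginary part in $(-\pi,\pi)$) and $(I_n-UU^T)V(U^TV)^{-1}=W\Sigma Z^T$ is any thin singular value decomposition ($W\in\mathbb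 R^{n\times p}$ with $W^TW=I_p$, $\Sigma$ diagonal and nonnegative, $Z\in O(p)$); in particular, the identity above also holds with both logarithms replaced by these closed forms. -/

import Mathlib

namespace Grass

noncomputable section

open Matrix Set
open scoped Matrix.Norms.Frobenius

/-- Real `n × m` matrices. -/
abbrev Mat (n m : ℕ) : Type := Matrix (Fin n) (Fin m) ℝ

/-! ### The two perspectives -/

/-- The Grassmannian in the projector perspective: orthogonal projectors of rank `p`. -/
def Gr (n p : ℕ) : Set (Mat n n) :=
  {P | Pᵀ = P ∧ P * P = P ∧ P.rank = p}

/-- Matrices with orthonormal columns (the Stiefel manifold); they represent the points of the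
Grassmannian in the ONB perspective, two of them representing the same point when they are
related by `SamePoint`. -/
def Onb (n p : ℕ) : Set (Mat n p) :=
  {U | Uᵀ * U = 1}

/-- `U` and `V` represent the same point of the Grassmannian in the ONB perspective, that is,
the same class in the quotient of the Stiefel manifold by the orthogonal group `O(p)`. -/
def SamePoint {n p : ℕ} (U V : Mat n p) : Prop :=
  ∃ R ∈ Matrix.orthogonalGroup (Fin p) ℝ, V = U * R

/-- The map `U ↦ U Uᵀ` from the ONB perspective to the projector perspective. -/
def tau {n p : ℕ} (U : Mat n p) : Mat n n := U * Uᵀ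

/-! ### The canonical metrics -/

/-- The canonical metric in the projector perspective, for `Δ₁`, `Δ₂` tangent at `P`.
The horizontal lift of a tangent vector `Δ` to an orthogonal matrix `O` over `P` is
`[Δ, P] O`, and the metric is one half of the trace inner product of the horizontal lifts
(the factor `O` cancels in the trace). -/
def grMetric {n : ℕ} (P Δ₁ Δ₂ : Mat n n) : ℝ :=
  (1 / 2) * ((⁅Δ₁, P⁆)ᵀ * ⁅Δ₂, P⁆).trace

/-- The canonical metric in the ONB perspective, for horizontal vectors `D₁`, `D₂` at `U`. -/
def onbMetric {n p : ℕ} (U D₁ D₂ : Mat n p) : ℝ :=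
  (D₁ᵀ * (1 - (1 / 2 : ℝ) • (U * Uᵀ)) * D₂).trace

/-- The horizontal part at `U` of a vector `D` tangent to the Stiefel manifold. -/
def horPart {n p : ℕ} (U D : Mat n p) : Mat n p := (1 - U * Uᵀ) * D

/-! ### Curves parametrized by `[0, 1]`, their speed and their length -/

/-- The velocity of a curve (one-sided at the end points `0` and `1`). -/
def velocity {n m : ℕ} (γ : ℝ → Mat n m) (t : ℝ) : Mat n m := derivWithin γ (Icc 0 1) t

/-- `γ` is, on `[0, 1]`, a `C¹` curve of projectors from `P` to `Q`. -/
def IsGrCurve {n : ℕ} (p : ℕ) (P Q : Mat n n) (γ : ℝ → Mat n n) : Prop :=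
  ContDiffOn ℝ 1 γ (Icc 0 1) ∧ (∀ t ∈ Icc (0 : ℝ) 1, γ t ∈ Gr n p) ∧ γ 0 = P ∧ γ 1 = Q

/-- Speed of a curve in the projector perspective. -/
def grSpeed {n : ℕ} (γ : ℝ → Mat n n) (t : ℝ) : ℝ :=
  √(grMetric (γ t) (velocity γ t) (velocity γ t))

/-- `γ` represents on `[0, 1]`, by orthonormal bases, a `C¹` curve in the ONB Grassmannian
which starts at the point of `U`, with the representative `U`, and ends at the point of `V`. -/
def IsOnbCurve {n p : ℕ} (U V : Mat n p) (γ : ℝ → Mat n p) : Prop :=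
  ContDiffOn ℝ 1 γ (Icc 0 1) ∧ (∀ t ∈ Icc (0 : ℝ) 1, γ t ∈ Onb n p) ∧ γ 0 = U ∧
    SamePoint V (γ 1)

/-- Speed of a curve in the ONB Grassmannian: the norm, in the canonical metric, of the
horizontal part of the velocity of a representing curve. -/
def onbSpeed {n p : ℕ} (γ : ℝ → Mat n p) (t : ℝ) : ℝ :=
  √(onbMetric (γ t) (horPart (γ t) (velocity γ t)) (horPart (γ t) (velocity γ t)))

/-- The length of a curve with the given speed. -/
def length (speed : ℝ → ℝ) : ℝ := ∫ t in (0 : ℝ)..1, speed t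

/-! ### Minimizing geodesics and the Riemannian logarithms -/

/-- `γ` is a minimizing geodesic from `P` to `Q` in the projector perspective, parametrized on
`[0, 1]`: a curve of constant speed and of least length among the curves from `P` to `Q`. -/
def IsGrMinGeodesic {n : ℕ} (p : ℕ) (P Q : Mat n n) (γ : ℝ → Mat n n) : Prop :=
  IsGrCurve p P Q γ ∧ (∃ c : ℝ, ∀ t ∈ Icc (0 : ℝ) 1, grSpeed γ t = c) ∧
    ∀ δ, IsGrCurve p P Q δ → length (grSpeed γ) ≤ length (grSpeed δ)

/-- `Δ` is the Riemannian logarithm of `Q` at `P` in the projector perspective: the initial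
velocity of the unique minimizing geodesic from `P` to `Q`. -/
def IsGrLog {n : ℕ} (p : ℕ) (P Q Δ : Mat n n) : Prop :=
  ∃ γ, IsGrMinGeodesic p P Q γ ∧ velocity γ 0 = Δ ∧
    ∀ δ, IsGrMinGeodesic p P Q δ → ∀ t ∈ Icc (0 : ℝ) 1, δ t = γ t

/-- `γ` represents a minimizing geodesic of the ONB Grassmannian, parametrized on `[0, 1]`,
from the point of `U` to the point of `V`. -/
def IsOnbMinGeodesic {n p : ℕ} (U V : Mat n p) (γ : ℝ → Mat n p) : Prop :=
  IsOnbCurve U V γ ∧ (∃ c : ℝ, ∀ t ∈ Icc (0 : ℝ) 1, onbSpeed γ t = c) ∧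
    ∀ δ, IsOnbCurve U V δ → length (onbSpeed γ) ≤ length (onbSpeed δ)

/-- `L` is the Riemannian logarithm of `V` at `U` in the ONB perspective: the horizontal vector
at `U` which represents the initial velocity of the unique minimizing geodesic from the point
of `U` to the point of `V`. -/
def IsOnbLog {n p : ℕ} (U V L : Mat n p) : Prop :=
  ∃ γ, IsOnbMinGeodesic U V γ ∧ horPart U (velocity γ 0) = L ∧
    ∀ δ, IsOnbMinGeodesic U V δ → ∀ t ∈ Icc (0 : ℝ) 1, SamePoint (γ t) (δ t)

/-! ### The closed forms of the logarithms -/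

/-- `X` is the (principal) matrix logarithm of `A`. -/
def IsMatrixLog {n : ℕ} (A X : Mat n n) : Prop :=
  NormedSpace.exp X = A ∧
    ∀ z ∈ spectrum ℂ (X.map (algebraMap ℝ ℂ)), |z.im| < Real.pi

/-- `Δ = [Ω, P]` with `Ω = (1/2) log ((I - 2 Q) (I - 2 P))`. -/
def IsGrLogFormula {n : ℕ} (P Q Δ : Mat n n) : Prop :=
  ∃ X, IsMatrixLog ((1 - (2 : ℝ) • Q) * (1 - (2 : ℝ) • P)) X ∧ Δ = ⁅(1 / 2 : ℝ) • X, P⁆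

/-- `M = W diag(σ) Zᵀ` is a (thin) singular value decomposition of `M`. -/
def IsThinSVD {n p : ℕ} (M W : Mat n p) (σ : Fin p → ℝ) (Z : Mat p p) : Prop :=
  Wᵀ * W = 1 ∧ Z ∈ Matrix.orthogonalGroup (Fin p) ℝ ∧ (∀ i, 0 ≤ σ i) ∧
    M = W * Matrix.diagonal σ * Zᵀ

/-- `L = W arctan(Σ) Zᵀ` with `(I - U Uᵀ) V (Uᵀ V)⁻¹ = W Σ Zᵀ` a singular value decomposition. -/
def IsOnbLogFormula {n p : ℕ} (U V L : Mat n p) : Prop :=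
  ∃ W σ Z, IsThinSVD ((1 - U * Uᵀ) * V * (Uᵀ * V)⁻¹) W σ Z ∧
    L = W * Matrix.diagonal (fun i => Real.arctan (σ i)) * Zᵀ

end

end Grass

/-! The map `tau` is an isometry from the ONB picture to the projector picture. If `D` is the
horizontal part of the velocity of `γ`, the velocity of `γ γᵀ` is `γ Dᵀ + D γᵀ`, and both metrics
give it the squared norm `Tr (Dᵀ D)`. Conversely, a curve `δ` of projectors has a horizontal lift,
the solution of `γ' = δ' γ` (`IsGrCurve.exists_lift`). So lengths, minimizing geodesics and their
uniqueness correspond (`isGrLog_iff`), and the logarithms are related by the differential of `tau`.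

When `Uᵀ V` is invertible, the singular value decomposition gives `a = U Z` and `θ = arctan σ < π /
2`, and the point of `V` is the end of `a cos (t θ) + W sin (t θ)`. Minimality is proved on columns.
In a horizontal lift of a competing curve, column `i` moves on the unit sphere from `aᵢ` to a vector
whose inner product with `aᵢ` is at most `cos θᵢ`, so its length is at least `θᵢ`. Cauchy–Schwarz
turns these bounds into the bound `√(∑ θᵢ²)` on the length of the curve. In the equality case with
constant speed, every column has speed `θᵢ` and runs along a great circle, which gives uniqueness
(`length_geodesic_le`).

For the projector formula, the geodesic is `exp (t Ω) a` with `Ω` skew-symmetric and anticommuting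
with the reflection `1 - 2P`. Hence `exp (2 Ω) = (1 - 2Q) (1 - 2P)`. The eigenvalues of `2 Ω` lie in
the strip of the principal logarithm, where the logarithm is unique (`IsMatrixLog.eq`). -/

namespace Grass

open Matrix Set
open scoped Matrix.Norms.Frobenius

/-! ### Calculus of matrix-valued curves on `[0, 1]`. -/

section Calculus

variable {l m n : ℕ}

/-- Multiplication of rectangular matrices as a continuous bilinear map. -/
noncomputable def mulCLM (l m n : ℕ) : Mat l m →L[ℝ] Mat m n →L[ℝ] Mat l n :=
  LinearMap.mkContinuous₂
    (LinearMap.mk₂ ℝ (fun (A : Mat l m) (B : Mat m n) => A * B) Matrix.add_mul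
      Matrix.smul_mul Matrix.mul_add (fun c A B => Matrix.mul_smul A c B)) 1
    (fun A B => by simpa using Matrix.frobenius_norm_mul A B)

lemma hasDerivWithinAt_mul {f : ℝ → Mat l m} {g : ℝ → Mat m n} {f' : Mat l m} {g' : Mat m n}
    {s : Set ℝ} {t : ℝ} (hf : HasDerivWithinAt f f' s t) (hg : HasDerivWithinAt g g' s t) :
    HasDerivWithinAt (fun t => f t * g t) (f' * g t + f t * g') s t := by
  have h := (mulCLM l m n).hasDerivWithinAt_of_bilinear hf hg
  rw [add_comm]
  exact h

lemma hasDerivWithinAt_transpose {f : ℝ → Mat l m} {f' : Mat l m}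
    {s : Set ℝ} {t : ℝ} (hf : HasDerivWithinAt f f' s t) :
    HasDerivWithinAt (fun t => (f t)ᵀ) f'ᵀ s t :=
  ((LinearMap.toContinuousLinearMap
    (Matrix.transposeLinearEquiv (Fin l) (Fin m) ℝ ℝ).toLinearMap).hasFDerivAt
      (x := f t)).comp_hasDerivWithinAt t hf

lemma hasDerivWithinAt_velocity {γ : ℝ → Mat m n} (h : ContDiffOn ℝ 1 γ (Icc 0 1)) {t : ℝ}
    (ht : t ∈ Icc (0 : ℝ) 1) : HasDerivWithinAt γ (velocity γ t) (Icc 0 1) t :=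
  ((h.differentiableOn one_ne_zero) t ht).hasDerivWithinAt

lemma continuousOn_velocity {γ : ℝ → Mat m n} (h : ContDiffOn ℝ 1 γ (Icc 0 1)) :
    ContinuousOn (velocity γ) (Icc 0 1) :=
  h.continuousOn_derivWithin (uniqueDiffOn_Icc zero_lt_one) le_rfl

lemma HasDerivWithinAt.velocity_eq {γ : ℝ → Mat m n} {γ' : Mat m n} {t : ℝ}
    (h : HasDerivWithinAt γ γ' (Icc 0 1) t) (ht : t ∈ Icc (0 : ℝ) 1) : velocity γ t = γ' :=
  h.derivWithin (uniqueDiffOn_Icc zero_lt_one t ht)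

lemma contDiffOn_of_hasDerivWithinAt {γ γ' : ℝ → Mat m n}
    (h : ∀ t ∈ Icc (0 : ℝ) 1, HasDerivWithinAt γ (γ' t) (Icc 0 1) t)
    (hc : ContinuousOn γ' (Icc 0 1)) : ContDiffOn ℝ 1 γ (Icc 0 1) := by
  rw [contDiffOn_one_iff_derivWithin (uniqueDiffOn_Icc zero_lt_one)]
  refine ⟨fun t ht => (h t ht).differentiableWithinAt, hc.congr fun t ht => ?_⟩
  exact HasDerivWithinAt.velocity_eq (h t ht) ht

lemma velocity_congr {γ δ : ℝ → Mat m n} (h : ∀ t ∈ Icc (0 : ℝ) 1, γ t = δ t) {t : ℝ}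
    (ht : t ∈ Icc (0 : ℝ) 1) : velocity γ t = velocity δ t :=
  derivWithin_congr h (h t ht)

lemma continuousOn_mul {f : ℝ → Mat l m} {g : ℝ → Mat m n} {s : Set ℝ}
    (hf : ContinuousOn f s) (hg : ContinuousOn g s) : ContinuousOn (fun t => f t * g t) s := by
  rw [continuousOn_iff_continuous_domRestrict] at *
  exact hf.matrix_mul hg

lemma continuousOn_transpose {f : ℝ → Mat l m} {s : Set ℝ}
    (hf : ContinuousOn f s) : ContinuousOn (fun t => (f t)ᵀ) s := by
  rw [continuousOn_iff_continuous_domRestrict] at *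
  exact hf.matrix_transpose

end Calculus

/-! ### Orthonormal bases and projectors: the bijection. -/

section Projectors

variable {n p : ℕ}

lemma SamePoint.tau_eq {U V : Mat n p} (h : SamePoint U V) : tau U = tau V := by
  obtain ⟨R, hR, rfl⟩ := h
  have : R * Rᵀ = 1 := (Matrix.mem_orthogonalGroup_iff _ _).1 hR
  rw [tau, tau, transpose_mul, Matrix.mul_assoc, ← Matrix.mul_assoc R, this, Matrix.one_mul]

lemma mem_orthogonalGroup_of_transpose_mul {R : Mat p p} (h : Rᵀ * R = 1) :
    R ∈ Matrix.orthogonalGroup (Fin p) ℝ :=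
  (Matrix.mem_orthogonalGroup_iff' _ _).2 h

lemma tau_mul_self {U : Mat n p} (hU : U ∈ Onb n p) : tau U * U = U := by
  rw [tau, Matrix.mul_assoc, show Uᵀ * U = 1 from hU, Matrix.mul_one]

/-- The rotation is `Uᵀ * V`: the common projector fixes `V`, so `U Uᵀ V = V`, and orthogonality
reduces to `Vᵀ V = 1`. -/
lemma samePoint_of_tau_eq {U V : Mat n p} (hV : V ∈ Onb n p)
    (h : tau U = tau V) : SamePoint U V := by
  have hV' : U * (Uᵀ * V) = V := by
    rw [← Matrix.mul_assoc, ← tau, h, tau_mul_self hV]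
  refine ⟨Uᵀ * V, mem_orthogonalGroup_of_transpose_mul ?_, hV'.symm⟩
  rw [transpose_mul, transpose_transpose, Matrix.mul_assoc, hV']
  exact hV

lemma tau_eq_iff {U V : Mat n p} (hV : V ∈ Onb n p) : tau U = tau V ↔ SamePoint U V :=
  ⟨samePoint_of_tau_eq hV, SamePoint.tau_eq⟩

lemma tau_mem_gr {U : Mat n p} (hU : U ∈ Onb n p) : tau U ∈ Gr n p := by
  refine ⟨by simp [tau], ?_, ?_⟩
  · nth_rewrite 2 [tau]
    rw [← Matrix.mul_assoc, tau_mul_self hU, tau]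
  · rw [tau, Matrix.rank_self_mul_transpose, ← Matrix.rank_transpose_mul_self,
      show Uᵀ * U = 1 from hU, Matrix.rank_one, Fintype.card_fin]

/-- The columns of `U` form an orthonormal basis of the range of `P`. -/
lemma exists_tau_eq {P : Mat n n} (hP : P ∈ Gr n p) : ∃ U ∈ Onb n p, tau U = P := by
  obtain ⟨hsymm, hidem, hrank⟩ := hP
  let K : Submodule ℝ (EuclideanSpace ℝ (Fin n)) := LinearMap.range (Matrix.toEuclideanLin P)
  have hK : Module.finrank ℝ K = p := by
    rw [← hrank, Matrix.rank_eq_finrank_range_toLin P (EuclideanSpace.basisFun (Fin n) ℝ).toBasis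
      (EuclideanSpace.basisFun (Fin n) ℝ).toBasis, ← Matrix.toEuclideanLin_eq_toLin_orthonormal]
  let b : OrthonormalBasis (Fin p) ℝ K := (stdOrthonormalBasis ℝ K).reindex (finCongr hK)
  let U : Mat n p := Matrix.of fun i j => (b j : EuclideanSpace ℝ (Fin n)) i
  have hU : U ∈ Onb n p := by
    show Uᵀ * U = 1
    ext i j
    have := orthonormal_iff_ite.1 b.orthonormal i j
    rw [Matrix.one_apply, ← this, Submodule.coe_inner, Matrix.mul_apply, PiLp.inner_apply]
    exact Finset.sum_congr rfl fun k _ => by simp [U, mul_comm]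
  have hPK : ∀ x ∈ K, Matrix.toEuclideanLin P x = x := by
    rintro _ ⟨y, rfl⟩
    ext i
    simp [Matrix.toLpLin_apply, Matrix.mulVec_mulVec, hidem]
  have hPU : P * U = U := by
    ext i j
    have := congrArg (fun v : EuclideanSpace ℝ (Fin n) => v i) (hPK (b j) (b j).2)
    simpa [Matrix.toLpLin_apply, Matrix.mulVec, dotProduct, Matrix.mul_apply, U] using this
  have hUP : U * Uᵀ * P = P := by
    ext i j
    -- Column `j` of `P` lies in the range; its expansion in the basis `b` is column `j` of `U Uᵀ
    -- P`.
    let x : K := ⟨Matrix.toEuclideanLin P (EuclideanSpace.single j 1), ⟨_, rfl⟩⟩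
    have hx : ∀ k, (x : EuclideanSpace ℝ (Fin n)) k = P k j := fun k => by
      simp [x, Matrix.toLpLin_apply]
    have h := b.sum_repr' x
    have h2 := congrArg (fun v : K => (v : EuclideanSpace ℝ (Fin n)) i) h
    rw [Matrix.mul_assoc, Matrix.mul_apply, ← hx i, ← h2]
    simp only [Submodule.coe_sum, Submodule.coe_smul, WithLp.ofLp_sum, Finset.sum_apply,
      PiLp.smul_apply, smul_eq_mul, Submodule.coe_inner, PiLp.inner_apply, hx, Matrix.mul_apply]
    refine Finset.sum_congr rfl fun k _ => ?_
    rw [mul_comm]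
    congr 1
    exact Finset.sum_congr rfl fun l _ => by simp [U, mul_comm]
  refine ⟨U, hU, ?_⟩
  have h3 : P * (U * Uᵀ) = U * Uᵀ := by rw [← Matrix.mul_assoc, hPU]
  have h4 := congrArg Matrix.transpose hUP
  rw [transpose_mul, transpose_mul, transpose_transpose, hsymm, h3] at h4
  exact h4

/-- Orthonormal columns fixed by a projector of the same rank span its range. -/
lemma tau_eq_of_mul_eq {P : Mat n n} (hP : P ∈ Gr n p) {U : Mat n p} (hU : U ∈ Onb n p)
    (h : P * U = U) : tau U = P := by
  obtain ⟨B, hB, rfl⟩ := exists_tau_eq hP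
  refine (SamePoint.tau_eq ⟨Bᵀ * U, mem_orthogonalGroup_of_transpose_mul ?_, ?_⟩).symm
  · rw [transpose_mul, transpose_transpose, Matrix.mul_assoc, ← Matrix.mul_assoc B, ← tau, h]
    exact hU
  · rw [← Matrix.mul_assoc, ← tau, h]

end Projectors

/-! ### The two metrics on horizontal vectors. -/

section Metrics

variable {n p : ℕ}

lemma transpose_mul_horPart {U : Mat n p} (hU : U ∈ Onb n p) (D : Mat n p) :
    Uᵀ * horPart U D = 0 := by
  rw [horPart, ← Matrix.mul_assoc, Matrix.mul_sub, ← Matrix.mul_assoc, show Uᵀ * U = 1 from hU]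
  simp

lemma onbMetric_of_horizontal {U D : Mat n p} (h : Uᵀ * D = 0) :
    onbMetric U D D = (Dᵀ * D).trace := by
  rw [onbMetric, Matrix.mul_assoc, Matrix.sub_mul, Matrix.smul_mul, Matrix.mul_assoc, h]
  simp

/-- The tangent vector in the projector perspective with horizontal lift `D` at `U`. -/
lemma grMetric_of_horizontal {U D : Mat n p} (hU : U ∈ Onb n p) (h : Uᵀ * D = 0) :
    grMetric (tau U) (U * Dᵀ + D * Uᵀ) (U * Dᵀ + D * Uᵀ) = (Dᵀ * D).trace := by
  have hU' : Uᵀ * U = 1 := hU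
  have h' : Dᵀ * U = 0 := by rw [← transpose_transpose U, ← transpose_mul, h, transpose_zero]
  -- The two terms of this commutator are orthogonal and have equal norms; this is what the factor
  -- `1 / 2` in the metric compensates.
  have e : ⁅U * Dᵀ + D * Uᵀ, tau U⁆ = D * Uᵀ - U * Dᵀ := by
    rw [Ring.lie_def, tau, Matrix.add_mul, Matrix.mul_add]
    have e1 : U * Dᵀ * (U * Uᵀ) = 0 := by
      rw [Matrix.mul_assoc, ← Matrix.mul_assoc Dᵀ, h']; simp
    have e2 : D * Uᵀ * (U * Uᵀ) = D * Uᵀ := by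
      rw [Matrix.mul_assoc, ← Matrix.mul_assoc Uᵀ, hU']; simp
    have e3 : U * Uᵀ * (U * Dᵀ) = U * Dᵀ := by
      rw [Matrix.mul_assoc, ← Matrix.mul_assoc Uᵀ, hU']; simp
    have e4 : U * Uᵀ * (D * Uᵀ) = 0 := by
      rw [Matrix.mul_assoc, ← Matrix.mul_assoc Uᵀ, h]; simp
    rw [e1, e2, e3, e4]; simp
  rw [grMetric, e]
  simp only [transpose_sub, transpose_mul, transpose_transpose, Matrix.sub_mul, Matrix.mul_sub,
    trace_sub]
  have e1 : U * Dᵀ * (U * Dᵀ) = 0 := by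
    rw [Matrix.mul_assoc, ← Matrix.mul_assoc Dᵀ, h']; simp
  have e2 : D * Uᵀ * (D * Uᵀ) = 0 := by
    rw [Matrix.mul_assoc, ← Matrix.mul_assoc Uᵀ, h]; simp
  have e3 : (U * Dᵀ * (D * Uᵀ)).trace = (Dᵀ * D).trace := by
    rw [Matrix.mul_assoc, Matrix.trace_mul_comm, Matrix.mul_assoc, Matrix.mul_assoc, hU']; simp
  have e4 : (D * Uᵀ * (U * Dᵀ)).trace = (Dᵀ * D).trace := by
    rw [Matrix.mul_assoc, ← Matrix.mul_assoc Uᵀ, hU', Matrix.one_mul, Matrix.trace_mul_comm]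
  rw [e1, e2, e3, e4, trace_zero]
  ring

end Metrics

/-! ### Linear differential equations for matrices. -/

section LinearODE

variable {m n : ℕ}

lemma norm_sq_eq_trace (A : Mat m n) : ‖A‖ ^ 2 = (Aᵀ * A).trace := by
  rw [Matrix.frobenius_norm_def, ← Real.sqrt_eq_rpow, Real.sq_sqrt (by positivity), Matrix.trace,
    Finset.sum_comm]
  refine Finset.sum_congr rfl fun j _ => ?_
  rw [Matrix.diag_apply, Matrix.mul_apply]
  refine Finset.sum_congr rfl fun i _ => ?_
  rw [transpose_apply, Real.rpow_two, Real.norm_eq_abs, sq_abs, sq]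

lemma norm_le_of_abs_le {A B : Mat m n} (h : ∀ i j, |A i j| ≤ |B i j|) : ‖A‖ ≤ ‖B‖ := by
  simp only [Matrix.frobenius_norm_def, Real.norm_eq_abs]
  exact Real.rpow_le_rpow (by positivity) (Finset.sum_le_sum fun i _ => Finset.sum_le_sum
    fun j _ => Real.rpow_le_rpow (abs_nonneg _) (h i j) (by norm_num)) (by norm_num)

lemma abs_le_norm (A : Mat m n) (i : Fin m) (j : Fin n) : |A i j| ≤ ‖A‖ := by
  refine abs_le_of_sq_le_sq ?_ (norm_nonneg _)
  rw [norm_sq_eq_trace, Matrix.trace]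
  calc A i j ^ 2 ≤ ∑ k, A k j ^ 2 :=
        Finset.single_le_sum (f := fun k => A k j ^ 2) (fun k _ => sq_nonneg _) (Finset.mem_univ i)
    _ = (Aᵀ * A).diag j := by simp [Matrix.mul_apply, sq]
    _ ≤ ∑ l, (Aᵀ * A).diag l :=
        Finset.single_le_sum (f := fun l => (Aᵀ * A).diag l)
          (fun l _ => by
            rw [Matrix.diag_apply, Matrix.mul_apply]
            exact Finset.sum_nonneg fun k _ => mul_self_nonneg _) (Finset.mem_univ j)

/-- The entries of a matrix, truncated to `[-C, C]`. -/
def clip (C : ℝ) (A : Mat m n) : Mat m n := A.map fun r => max (-C) (min C r)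

lemma clip_eq_self {C : ℝ} {A : Mat m n} (h : ‖A‖ ≤ C) : clip C A = A := by
  ext i j
  have := abs_le.1 ((abs_le_norm A i j).trans h)
  simp [clip, this.1, this.2]

lemma norm_clip_sub_le (C : ℝ) (A B : Mat m n) : ‖clip C A - clip C B‖ ≤ ‖A - B‖ :=
  norm_le_of_abs_le fun i j => by
    simp only [clip, Matrix.sub_apply, map_apply]
    refine (abs_max_sub_max_le_max (-C) _ (-C) _).trans ?_
    rw [sub_self, abs_zero, max_eq_right (abs_nonneg _)]
    refine (abs_min_sub_min_le_max C _ C _).trans ?_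
    rw [sub_self, abs_zero, max_eq_right (abs_nonneg _)]

lemma norm_clip_le {C : ℝ} (hC : 0 ≤ C) (A : Mat m n) : ‖clip C A‖ ≤ ‖A‖ := by
  have h0 : clip C (0 : Mat m n) = 0 := clip_eq_self (by simpa)
  simpa [h0] using norm_clip_sub_le C A 0

lemma norm_clip_le_const {C : ℝ} (hC : 0 ≤ C) (A : Mat m n) :
    ‖clip C A‖ ≤ ‖(Matrix.of fun _ _ => C : Mat m n)‖ :=
  norm_le_of_abs_le fun i j => by
    simp only [clip, map_apply, of_apply]
    rw [abs_of_nonneg hC, abs_le]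
    exact ⟨le_max_left _ _, max_le (by linarith) (min_le_left _ _)⟩

/-- A linear differential equation with continuous coefficients is solvable on `[0, 1]`. -/
lemma exists_linear_ode {A : ℝ → Mat m m} (hA : ContinuousOn A (Icc 0 1)) (x₀ : Mat m n) :
    ∃ x : ℝ → Mat m n, x 0 = x₀ ∧
      ∀ t ∈ Icc (0 : ℝ) 1, HasDerivWithinAt x (A t * x t) (Icc 0 1) t := by
  obtain ⟨K, hK⟩ := isCompact_Icc.exists_bound_of_continuousOn hA
  have hK0 : 0 ≤ K := (norm_nonneg _).trans (hK 0 (by simp))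
  -- `C` is the Grönwall bound for the solution. Truncating at `C` makes the right-hand side
  -- bounded, so Picard–Lindelöf reaches all of `[0, 1]`; by the bound, the truncation is never
  -- active along the solution.
  set C : ℝ := ‖x₀‖ * Real.exp K with hCdef
  have hC : 0 ≤ C := by positivity
  set B : ℝ := ‖(Matrix.of fun _ _ => C : Mat m n)‖
  have hB : 0 ≤ B := norm_nonneg _
  let f : ℝ → Mat m n → Mat m n := fun t x => A t * clip C x
  have hpl : IsPicardLindelof f (tmin := 0) (tmax := 1) ⟨0, by simp⟩ x₀ (K * B).toNNReal 0
      (K * B).toNNReal K.toNNReal := by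
    refine ⟨fun t ht => ?_, fun x _ => ?_, fun t ht x _ => ?_, ?_⟩
    · refine LipschitzOnWith.of_dist_le_mul fun x _ y _ => ?_
      rw [dist_eq_norm, dist_eq_norm, Real.coe_toNNReal _ hK0, ← Matrix.mul_sub]
      exact (frobenius_norm_mul _ _).trans
        (mul_le_mul (hK t ht) (norm_clip_sub_le C x y) (norm_nonneg _) hK0)
    · exact continuousOn_mul hA continuousOn_const
    · rw [Real.coe_toNNReal _ (by positivity)]
      exact (frobenius_norm_mul _ _).trans
        (mul_le_mul (hK t ht) (norm_clip_le_const hC x) (norm_nonneg _) hK0)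
    · simp
  obtain ⟨x, hx0, hx⟩ := hpl.exists_eq_forall_mem_Icc_hasDerivWithinAt₀
  refine ⟨x, hx0, fun t ht => ?_⟩
  suffices h : ‖x t‖ ≤ C by
    have := hx t ht
    simp only [f, clip_eq_self h] at this
    exact this
  have hg := norm_le_gronwallBound_of_norm_deriv_right_le (f := x) (f' := fun t => f t (x t))
    (δ := ‖x₀‖) (K := K) (ε := 0) (a := 0) (b := 1)
    (fun s hs => (hx s hs).continuousWithinAt)
    (fun s hs => ((hx s (Ico_subset_Icc_self hs)).mono_of_mem_nhdsWithin
      (Icc_mem_nhdsGE_of_mem hs)))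
    (by simp [hx0])
    (fun s hs => by
      rw [add_zero]
      exact (frobenius_norm_mul _ _).trans (mul_le_mul (hK s (Ico_subset_Icc_self hs))
        (norm_clip_le hC _) (norm_nonneg _) hK0)) t ht
  rw [gronwallBound_ε0, sub_zero] at hg
  refine hg.trans ?_
  rw [hCdef]
  gcongr
  nlinarith [ht.2]

lemma eq_zero_of_linear_ode {A : ℝ → Mat m m} (hA : ContinuousOn A (Icc 0 1)) {x : ℝ → Mat m n}
    (h0 : x 0 = 0) (hx : ∀ t ∈ Icc (0 : ℝ) 1, HasDerivWithinAt x (A t * x t) (Icc 0 1) t) :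
    ∀ t ∈ Icc (0 : ℝ) 1, x t = 0 := by
  obtain ⟨K, hK⟩ := isCompact_Icc.exists_bound_of_continuousOn hA
  exact eq_zero_of_abs_deriv_le_mul_abs_self_of_eq_zero_right (K := K)
    (fun s hs => (hx s hs).continuousWithinAt)
    (fun s hs => ((hx s (Ico_subset_Icc_self hs)).mono_of_mem_nhdsWithin
      (Icc_mem_nhdsGE_of_mem hs))) h0
    (fun s hs => (frobenius_norm_mul _ _).trans
      (mul_le_mul_of_nonneg_right (hK s (Ico_subset_Icc_self hs)) (norm_nonneg _)))

lemma eq_of_hasDerivWithinAt_zero {x : ℝ → Mat m n}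
    (hx : ∀ t ∈ Icc (0 : ℝ) 1, HasDerivWithinAt x 0 (Icc 0 1) t) :
    ∀ t ∈ Icc (0 : ℝ) 1, x t = x 0 := by
  intro t ht
  have := eq_zero_of_linear_ode (A := fun _ => 0) (x := fun t => x t - x 0) continuousOn_const
    (sub_self _) (fun s hs => by
      rw [Matrix.zero_mul]; exact (hx s hs).sub_const (x 0)) t ht
  exact sub_eq_zero.1 this

end LinearODE

/-! ### Horizontal lifts. -/

section Lift

variable {n p : ℕ}

/-- Differentiating `δ² = δ` gives the first identity; multiplying it by `δ` on both sides gives `δ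
δ' δ = 2 δ δ' δ`. -/
lemma mul_velocity_mul_eq_zero {P Q : Mat n n} {δ : ℝ → Mat n n} (h : IsGrCurve p P Q δ) {t : ℝ}
    (ht : t ∈ Icc (0 : ℝ) 1) :
    velocity δ t = velocity δ t * δ t + δ t * velocity δ t ∧ δ t * velocity δ t * δ t = 0 := by
  have hd := hasDerivWithinAt_velocity h.1 ht
  have hi : δ t * δ t = δ t := (h.2.1 t ht).2.1
  have h1 : velocity δ t = velocity δ t * δ t + δ t * velocity δ t :=
    HasDerivWithinAt.velocity_eq ((hasDerivWithinAt_mul hd hd).congr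
      (fun s hs => (h.2.1 s hs).2.1.symm) hi.symm) ht
  refine ⟨h1, ?_⟩
  have h2 := congrArg (fun X => δ t * X * δ t) h1
  simp only [Matrix.mul_add, Matrix.add_mul] at h2
  rw [Matrix.mul_assoc _ (velocity δ t * δ t), Matrix.mul_assoc (velocity δ t), hi,
    ← Matrix.mul_assoc (δ t) (δ t), hi, ← Matrix.mul_assoc] at h2
  exact left_eq_add.1 h2

/-- Horizontal lifts of curves of projectors. -/
lemma IsGrCurve.exists_lift {P Q : Mat n n} {δ : ℝ → Mat n n} (h : IsGrCurve p P Q δ)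
    {U : Mat n p} (hU : U ∈ Onb n p) (hUP : tau U = P) :
    ∃ γ : ℝ → Mat n p, ContDiffOn ℝ 1 γ (Icc 0 1) ∧ (∀ t ∈ Icc (0 : ℝ) 1, γ t ∈ Onb n p) ∧
      γ 0 = U ∧ (∀ t ∈ Icc (0 : ℝ) 1, tau (γ t) = δ t) ∧
      ∀ t ∈ Icc (0 : ℝ) 1, (γ t)ᵀ * velocity γ t = 0 := by
  have hcv := continuousOn_velocity h.1
  have hδc : ContinuousOn δ (Icc 0 1) := h.1.continuousOn
  obtain ⟨γ, hγ0, hγ⟩ := exists_linear_ode hcv U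
  have hγc : ContinuousOn γ (Icc 0 1) := fun s hs => (hγ s hs).continuousWithinAt
  have hfix : ∀ t ∈ Icc (0 : ℝ) 1, δ t * γ t = γ t := by
    intro t ht
    -- The defect `x = δ γ - γ` has derivative `δ δ' γ`, which equals `-(δ δ') x` because `δ δ' δ =
    -- 0`.
    refine sub_eq_zero.1 (eq_zero_of_linear_ode (A := fun t => -(δ t * velocity δ t))
      (x := fun t => δ t * γ t - γ t) (continuousOn_mul hδc hcv).neg ?_ ?_ t ht)
    · show δ 0 * γ 0 - γ 0 = 0
      rw [hγ0, h.2.2.1, ← hUP, tau_mul_self hU, sub_self]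
    · intro s hs
      refine ((hasDerivWithinAt_mul (hasDerivWithinAt_velocity h.1 hs) (hγ s hs)).sub
        (hγ s hs)).congr_deriv ?_
      have := (mul_velocity_mul_eq_zero h hs).2
      rw [Matrix.mul_sub, Matrix.neg_mul, Matrix.neg_mul, ← Matrix.mul_assoc (δ s * velocity δ s),
        this, Matrix.mul_assoc]
      simp
  have hhor : ∀ t ∈ Icc (0 : ℝ) 1, (γ t)ᵀ * (velocity δ t * γ t) = 0 := by
    intro t ht
    have h1 : (γ t)ᵀ * δ t = (γ t)ᵀ := by
      have := congrArg Matrix.transpose (hfix t ht)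
      rwa [transpose_mul, (h.2.1 t ht).1] at this
    rw [← h1, ← hfix t ht, Matrix.mul_assoc, ← Matrix.mul_assoc (velocity δ t),
      ← Matrix.mul_assoc (δ t), ← Matrix.mul_assoc (δ t), (mul_velocity_mul_eq_zero h ht).2]
    simp
  have honb : ∀ t ∈ Icc (0 : ℝ) 1, γ t ∈ Onb n p := by
    intro t ht
    have := eq_of_hasDerivWithinAt_zero (x := fun t => (γ t)ᵀ * γ t) (fun s hs => by
      refine (hasDerivWithinAt_mul (hasDerivWithinAt_transpose (hγ s hs)) (hγ s hs)).congr_deriv ?_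
      rw [hhor s hs, ← transpose_transpose (γ s), ← transpose_mul, transpose_transpose, hhor s hs]
      simp) t ht
    show (γ t)ᵀ * γ t = 1
    rw [this, hγ0]
    exact hU
  refine ⟨γ, contDiffOn_of_hasDerivWithinAt hγ (continuousOn_mul hcv hγc), honb, hγ0,
    fun t ht => tau_eq_of_mul_eq (h.2.1 t ht) (honb t ht) (hfix t ht), fun t ht => ?_⟩
  rw [HasDerivWithinAt.velocity_eq (hγ t ht) ht]
  exact hhor t ht

end Lift

/-! ### Comparison of curves, geodesics and logarithms in the two perspectives. -/

section Projection

variable {n p : ℕ}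

/-- The velocity of the projected curve is the tangent vector of the horizontal part. -/
lemma velocity_tau {γ : ℝ → Mat n p} (hγ : ContDiffOn ℝ 1 γ (Icc 0 1))
    (ho : ∀ t ∈ Icc (0 : ℝ) 1, γ t ∈ Onb n p) {t : ℝ} (ht : t ∈ Icc (0 : ℝ) 1) :
    velocity (fun t => tau (γ t)) t =
      γ t * (horPart (γ t) (velocity γ t))ᵀ + horPart (γ t) (velocity γ t) * (γ t)ᵀ := by
  have hd := hasDerivWithinAt_velocity hγ ht
  rw [show velocity (fun t => tau (γ t)) t = _ from HasDerivWithinAt.velocity_eq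
    (hasDerivWithinAt_mul hd (hasDerivWithinAt_transpose hd)) ht]
  have h1 : (velocity γ t)ᵀ * γ t + (γ t)ᵀ * velocity γ t = 0 := by
    have h2 := HasDerivWithinAt.velocity_eq
      (hasDerivWithinAt_mul (hasDerivWithinAt_transpose hd) hd) ht
    rw [← h2, velocity_congr (δ := fun _ => (1 : Mat p p)) (fun s hs => ho s hs) ht]
    exact HasDerivWithinAt.velocity_eq (hasDerivWithinAt_const _ _ _) ht
  -- Since `γᵀ γ'` is skew-symmetric, the vertical contributions to the two terms of `(γ γᵀ)'`
  -- cancel.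
  have h3 : γ t * ((velocity γ t)ᵀ * γ t) * (γ t)ᵀ + γ t * ((γ t)ᵀ * velocity γ t) * (γ t)ᵀ = 0 := by
    rw [← Matrix.add_mul, ← Matrix.mul_add, h1]; simp
  simp only [horPart, Matrix.sub_mul, transpose_sub, transpose_mul, transpose_transpose,
    Matrix.mul_sub, Matrix.one_mul, Matrix.mul_assoc] at h3 ⊢
  rw [eq_neg_of_add_eq_zero_left h3]
  abel

lemma IsOnbCurve.isGrCurve {U V : Mat n p} {γ : ℝ → Mat n p} (h : IsOnbCurve U V γ) :
    IsGrCurve p (tau U) (tau V) fun t => tau (γ t) := by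
  refine ⟨contDiffOn_of_hasDerivWithinAt (fun t ht => ?_)
    ((continuousOn_mul (continuousOn_velocity h.1) (continuousOn_transpose h.1.continuousOn)).add
      (continuousOn_mul h.1.continuousOn (continuousOn_transpose (continuousOn_velocity h.1)))),
    fun t ht => tau_mem_gr (h.2.1 t ht), by simp only [h.2.2.1], h.2.2.2.tau_eq.symm⟩
  have hd := hasDerivWithinAt_velocity h.1 ht
  exact hasDerivWithinAt_mul hd (hasDerivWithinAt_transpose hd)

lemma grSpeed_tau {γ : ℝ → Mat n p} (hγ : ContDiffOn ℝ 1 γ (Icc 0 1))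
    (ho : ∀ t ∈ Icc (0 : ℝ) 1, γ t ∈ Onb n p) {t : ℝ} (ht : t ∈ Icc (0 : ℝ) 1) :
    grSpeed (fun t => tau (γ t)) t = onbSpeed γ t := by
  have hh := transpose_mul_horPart (ho t ht) (velocity γ t)
  rw [grSpeed, onbSpeed, velocity_tau hγ ho ht, grMetric_of_horizontal (ho t ht) hh,
    onbMetric_of_horizontal hh]

lemma grSpeed_congr {γ δ : ℝ → Mat n n} (h : ∀ t ∈ Icc (0 : ℝ) 1, γ t = δ t) {t : ℝ}
    (ht : t ∈ Icc (0 : ℝ) 1) : grSpeed γ t = grSpeed δ t := by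
  rw [grSpeed, grSpeed, velocity_congr h ht, h t ht]

lemma length_congr {f g : ℝ → ℝ} (h : ∀ t ∈ Icc (0 : ℝ) 1, f t = g t) : length f = length g :=
  intervalIntegral.integral_congr fun t ht => h t (by rwa [uIcc_of_le zero_le_one] at ht)

lemma IsGrCurve.congr {P Q : Mat n n} {γ δ : ℝ → Mat n n} (h : IsGrCurve p P Q γ)
    (he : ∀ t ∈ Icc (0 : ℝ) 1, δ t = γ t) : IsGrCurve p P Q δ :=
  ⟨h.1.congr he, fun t ht => he t ht ▸ h.2.1 t ht, (he 0 (by simp)).trans h.2.2.1,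
    (he 1 (by simp)).trans h.2.2.2⟩

lemma IsGrMinGeodesic.congr {P Q : Mat n n} {γ δ : ℝ → Mat n n} (h : IsGrMinGeodesic p P Q γ)
    (he : ∀ t ∈ Icc (0 : ℝ) 1, δ t = γ t) : IsGrMinGeodesic p P Q δ := by
  obtain ⟨h1, ⟨c, hc⟩, h3⟩ := h
  refine ⟨h1.congr he, ⟨c, fun t ht => (grSpeed_congr he ht).trans (hc t ht)⟩, fun ε hε => ?_⟩
  rw [length_congr fun t ht => grSpeed_congr he ht]
  exact h3 ε hε

/-- A curve in the ONB perspective is a minimizing geodesic iff its projection is one. -/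
lemma IsOnbCurve.isGrMinGeodesic_iff {U V : Mat n p} (hU : U ∈ Onb n p) {γ : ℝ → Mat n p}
    (h : IsOnbCurve U V γ) :
    IsGrMinGeodesic p (tau U) (tau V) (fun t => tau (γ t)) ↔ IsOnbMinGeodesic U V γ := by
  have hs : ∀ {γ : ℝ → Mat n p}, IsOnbCurve U V γ → ∀ t ∈ Icc (0 : ℝ) 1,
    grSpeed (fun t => tau (γ t)) t = onbSpeed γ t := fun h t ht => grSpeed_tau h.1 h.2.1 ht
  constructor
  · rintro ⟨-, ⟨c, hc⟩, h3⟩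
    refine ⟨h, ⟨c, fun t ht => (hs h t ht).symm.trans (hc t ht)⟩, fun ε hε => ?_⟩
    rw [← length_congr (hs h), ← length_congr (hs hε)]
    exact h3 _ hε.isGrCurve
  · rintro ⟨-, ⟨c, hc⟩, h3⟩
    refine ⟨h.isGrCurve, ⟨c, fun t ht => (hs h t ht).trans (hc t ht)⟩, fun ε hε => ?_⟩
    -- A competing curve of projectors may not come from a given ONB curve; its lift is an ONB
    -- competitor of the same length.
    obtain ⟨η, h1, h2, h4, h5, -⟩ := hε.exists_lift hU rfl
    have hη : IsOnbCurve U V η := ⟨h1, h2, h4, samePoint_of_tau_eq (h2 1 (by simp))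
      ((h5 1 (by simp)).trans hε.2.2.2).symm⟩
    rw [length_congr (hs h), ← length_congr fun t ht => grSpeed_congr h5 ht, length_congr (hs hη)]
    exact h3 _ hη

lemma IsGrMinGeodesic.exists_lift {U V : Mat n p} (hU : U ∈ Onb n p)
    {δ : ℝ → Mat n n} (h : IsGrMinGeodesic p (tau U) (tau V) δ) :
    ∃ γ, IsOnbMinGeodesic U V γ ∧ ∀ t ∈ Icc (0 : ℝ) 1, tau (γ t) = δ t := by
  obtain ⟨η, h1, h2, h4, h5, -⟩ := h.1.exists_lift hU rfl
  have hη : IsOnbCurve U V η := ⟨h1, h2, h4, samePoint_of_tau_eq (h2 1 (by simp))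
    ((h5 1 (by simp)).trans h.1.2.2.2).symm⟩
  exact ⟨η, (hη.isGrMinGeodesic_iff hU).1 (h.congr h5), h5⟩

lemma IsOnbMinGeodesic.isGrMinGeodesic {U V : Mat n p} (hU : U ∈ Onb n p)
    {γ : ℝ → Mat n p} (h : IsOnbMinGeodesic U V γ) :
    IsGrMinGeodesic p (tau U) (tau V) (fun t => tau (γ t)) :=
  (h.1.isGrMinGeodesic_iff hU).2 h

lemma IsOnbCurve.velocity_tau_zero {U V : Mat n p} {γ : ℝ → Mat n p} (h : IsOnbCurve U V γ) :
    velocity (fun t => tau (γ t)) 0 =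
      U * (horPart U (velocity γ 0))ᵀ + horPart U (velocity γ 0) * Uᵀ := by
  rw [velocity_tau h.1 h.2.1 (by simp), h.2.2.1]

/-- The logarithms in the two perspectives correspond to each other. -/
lemma isGrLog_iff {U V : Mat n p} (hU : U ∈ Onb n p) (Δ : Mat n n) :
    IsGrLog p (tau U) (tau V) Δ ↔ ∃ L : Mat n p, IsOnbLog U V L ∧ Δ = U * Lᵀ + L * Uᵀ := by
  constructor
  · rintro ⟨δ, hδ, rfl, huniq⟩
    obtain ⟨γ, hγ, he⟩ := hδ.exists_lift hU
    refine ⟨_, ⟨γ, hγ, rfl, fun ε hε t ht => samePoint_of_tau_eq (hε.1.2.1 t ht) ?_⟩, ?_⟩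
    · rw [he t ht, huniq _ (hε.isGrMinGeodesic hU) t ht]
    · rw [← hγ.1.velocity_tau_zero, velocity_congr he (by simp)]
  · rintro ⟨_, ⟨γ, hγ, rfl, huniq⟩, rfl⟩
    refine ⟨_, hγ.isGrMinGeodesic hU, hγ.1.velocity_tau_zero, fun δ hδ t ht => ?_⟩
    obtain ⟨ε, hε, he⟩ := hδ.exists_lift hU
    rw [← he t ht]
    exact (huniq ε hε t ht).tau_eq.symm

lemma IsGrLog.unique {P Q Δ Δ' : Mat n n} (h : IsGrLog p P Q Δ) (h' : IsGrLog p P Q Δ') :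
    Δ = Δ' := by
  obtain ⟨γ, -, rfl, hu⟩ := h
  obtain ⟨δ, hδ, rfl, -⟩ := h'
  exact (velocity_congr (hu δ hδ) (by simp)).symm

lemma IsOnbLog.horizontal {U V L : Mat n p} (hU : U ∈ Onb n p) (h : IsOnbLog U V L) :
    Uᵀ * L = 0 := by
  obtain ⟨γ, -, rfl, -⟩ := h
  exact transpose_mul_horPart hU _

/-- A horizontal vector is determined by its tangent vector in the projector perspective. -/
lemma horizontal_injective {U L L' : Mat n p} (hU : U ∈ Onb n p) (h : Uᵀ * L = 0)
    (h' : Uᵀ * L' = 0) (he : U * Lᵀ + L * Uᵀ = U * L'ᵀ + L' * Uᵀ) : L = L' := by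
  have aux : ∀ {L : Mat n p}, Uᵀ * L = 0 → (U * Lᵀ + L * Uᵀ) * U = L := fun {L} h => by
    have h2 : Lᵀ * U = 0 := by rw [← transpose_transpose U, ← transpose_mul, h, transpose_zero]
    rw [Matrix.add_mul, Matrix.mul_assoc, h2, Matrix.mul_assoc, show Uᵀ * U = 1 from hU]
    simp
  rw [← aux h, he, aux h']

end Projection

/-! ### Arcs on the unit sphere. -/

section Sphere

variable {E : Type*} [NormedAddCommGroup E] [InnerProductSpace ℝ E]

/-- Only the component of `a` orthogonal to `u` pairs with `v`, and that component has norm `√(1 -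
⟪a, u⟫²)`. -/
lemma abs_inner_le_of_orthogonal {a u v : E} (ha : ‖a‖ = 1) (hu : ‖u‖ = 1)
    (huv : inner ℝ u v = 0) : |inner ℝ a v| ≤ √(1 - inner ℝ a u ^ 2) * ‖v‖ := by
  have h1 : inner ℝ a v = inner ℝ (a - (inner ℝ a u : ℝ) • u) v := by
    rw [inner_sub_left, inner_smul_left, huv]; simp
  have h2 : ‖a - (inner ℝ a u : ℝ) • u‖ = √(1 - inner ℝ a u ^ 2) := by
    rw [← Real.sqrt_sq (norm_nonneg _), norm_sub_sq_real, inner_smul_right, norm_smul, ha, hu,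
      Real.norm_eq_abs, mul_one, sq_abs]
    congr 1
    ring
  rw [h1, ← h2]
  exact abs_real_inner_le_norm _ _

/-- The length of a curve on the unit sphere is at least the angle between its end points. -/
lemma arccos_inner_le_integral {u u' : ℝ → E} {s t : ℝ} (hst : s ≤ t)
    (hu : ∀ r ∈ Icc s t, HasDerivWithinAt u (u' r) (Icc s t) r)
    (hc : ContinuousOn u' (Icc s t)) (h1 : ∀ r ∈ Icc s t, ‖u r‖ = 1) :
    Real.arccos (inner ℝ (u s) (u t)) ≤ ∫ r in s..t, ‖u' r‖ := by
  have hs : s ∈ Icc s t := ⟨le_rfl, hst⟩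
  have ht : t ∈ Icc s t := ⟨hst, le_rfl⟩
  have hcu : ContinuousOn u (Icc s t) := fun r hr => (hu r hr).continuousWithinAt
  set g : ℝ → ℝ := fun r => inner ℝ (u s) (u r) with hg
  have hgc : ContinuousOn g (Icc s t) := continuousOn_const.inner hcu
  have hgabs : ∀ r ∈ Icc s t, |g r| ≤ 1 := fun r hr =>
    (abs_real_inner_le_norm _ _).trans (by rw [h1 s hs, h1 r hr, one_mul])
  have hni : ContinuousOn (fun r => ‖u' r‖) (Icc s t) := hc.norm
  have hint : IntervalIntegrable (fun r => ‖u' r‖) MeasureTheory.volume s t :=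
    hni.intervalIntegrable_of_Icc hst
  -- `arccos` is not differentiable at `±1`, where `g` may take values (`g s = 1`). Scaling by `c <
  -- 1` avoids these points, and `c → 1` recovers the claim.
  have key : ∀ c : ℝ, 0 ≤ c → c < 1 → Real.arccos (c * g t) - Real.arccos (c * g s) ≤
      ∫ r in s..t, ‖u' r‖ := by
    intro c hc0 hc1
    refine intervalIntegral.sub_le_integral_of_hasDeriv_right_of_le hst
      (g' := fun r => -(1 / √(1 - (c * g r) ^ 2)) * (c * inner ℝ (u s) (u' r)))
      (Real.continuous_arccos.comp_continuousOn (continuousOn_const.mul hgc)) (fun r hr => ?_)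
      ((intervalIntegrable_iff_integrableOn_Icc_of_le hst).1 hint) (fun r hr => ?_)
    · have hr' := Ioo_subset_Icc_self hr
      have hlt : |c * g r| < 1 := by
        rw [abs_mul, abs_of_nonneg hc0]
        nlinarith [hgabs r hr', abs_nonneg (g r)]
      have hd : HasDerivAt u (u' r) r := (hu r hr').hasDerivAt (Icc_mem_nhds hr.1 hr.2)
      have hgd : HasDerivAt g (inner ℝ (u s) (u' r)) r := by
        simpa using (hasDerivAt_const r (u s)).inner ℝ hd
      exact ((Real.hasDerivAt_arccos (abs_lt.1 hlt).1.ne' (abs_lt.1 hlt).2.ne).comp r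
        (hgd.const_mul c)).hasDerivWithinAt
    · have hr' := Ioo_subset_Icc_self hr
      have hperp : inner ℝ (u r) (u' r) = 0 := by
        have hd : HasDerivAt u (u' r) r := (hu r hr').hasDerivAt (Icc_mem_nhds hr.1 hr.2)
        have h2 : HasDerivAt (fun r => (inner ℝ (u r) (u r) : ℝ)) 0 r := by
          refine (hasDerivAt_const r (1 : ℝ)).congr_of_eventuallyEq ?_
          filter_upwards [Icc_mem_nhds hr.1 hr.2] with x hx
          rw [real_inner_self_eq_norm_sq, h1 x hx, one_pow]
        have h3 := (hd.inner ℝ hd).unique h2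
        rw [real_inner_comm (u r) (u' r)] at h3
        linarith
      have hb := abs_inner_le_of_orthogonal (h1 s hs) (h1 r hr') hperp
      have hg2 : g r ^ 2 ≤ 1 := by rw [sq_le_one_iff_abs_le_one]; exact hgabs r hr'
      have hpos : 0 < 1 - (c * g r) ^ 2 := by nlinarith [mul_nonneg hc0 hc0]
      have hsq : c * √(1 - g r ^ 2) ≤ √(1 - (c * g r) ^ 2) := by
        rw [← Real.sqrt_sq hc0, ← Real.sqrt_mul (sq_nonneg c), Real.sqrt_sq hc0]
        exact Real.sqrt_le_sqrt (by nlinarith)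
      refine (le_abs_self _).trans ?_
      rw [abs_mul, abs_neg, abs_of_nonneg (by positivity), abs_mul, abs_of_nonneg hc0,
        div_mul_eq_mul_div, one_mul, div_le_iff₀ (Real.sqrt_pos.2 hpos)]
      calc c * |inner ℝ (u s) (u' r)| ≤ c * (√(1 - g r ^ 2) * ‖u' r‖) := by gcongr
        _ = c * √(1 - g r ^ 2) * ‖u' r‖ := by ring
        _ ≤ √(1 - (c * g r) ^ 2) * ‖u' r‖ := by gcongr
        _ = _ := mul_comm _ _
  have hgs : g s = 1 := by rw [hg]; simp only; rw [real_inner_self_eq_norm_sq, h1 s hs, one_pow]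
  have hlim : Filter.Tendsto (fun c : ℝ => Real.arccos (c * g t) - Real.arccos (c * g s))
      (nhdsWithin 1 (Iio 1)) (nhds (Real.arccos (1 * g t) - Real.arccos (1 * g s))) :=
    Continuous.tendsto' (by fun_prop) _ _ rfl |>.mono_left nhdsWithin_le_nhds
  have := le_of_tendsto hlim (by
    filter_upwards [Ioo_mem_nhdsLT (show (0 : ℝ) < 1 by norm_num)] with c hc
      using key c hc.1.le hc.2)
  simpa [hgs] using this

lemma eq_of_one_le_inner {u v : E} (hu : ‖u‖ = 1) (hv : ‖v‖ = 1) (h : 1 ≤ (inner ℝ u v : ℝ)) :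
    u = v := by
  rw [← sub_eq_zero, ← norm_eq_zero, ← sq_eq_zero_iff]
  refine le_antisymm ?_ (sq_nonneg _)
  rw [norm_sub_sq_real, hu, hv]
  linarith

/-- A curve on the sphere of constant speed `θ` between points at angle `θ < π / 2` is the arc of
the great circle. -/
lemma eq_great_circle {u u' : ℝ → E} {θ : ℝ} (h0 : 0 ≤ θ) (hpi : θ < Real.pi / 2)
    (hu : ∀ r ∈ Icc (0 : ℝ) 1, HasDerivWithinAt u (u' r) (Icc 0 1) r)
    (hc : ContinuousOn u' (Icc 0 1)) (h1 : ∀ r ∈ Icc (0 : ℝ) 1, ‖u r‖ = 1)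
    (hs : ∀ r ∈ Icc (0 : ℝ) 1, ‖u' r‖ = θ) {b : E} (hb : θ ≠ 0 → inner ℝ (u 0) b = 0)
    (hb1 : ‖b‖ = 1) (hend : u 1 = Real.cos θ • u 0 + Real.sin θ • b) :
    ∀ t ∈ Icc (0 : ℝ) 1, u t = Real.cos (t * θ) • u 0 + Real.sin (t * θ) • b := by
  intro t ht
  have hlow : ∀ s r : ℝ, 0 ≤ s → s ≤ r → r ≤ 1 →
      Real.cos ((r - s) * θ) ≤ inner ℝ (u s) (u r) := by
    intro s r hs0 hsr hr1
    have hsub : Icc s r ⊆ Icc (0 : ℝ) 1 := Icc_subset_Icc hs0 hr1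
    have h2 := arccos_inner_le_integral hsr
      (fun x hx => (hu x (hsub hx)).mono hsub) (hc.mono hsub) (fun x hx => h1 x (hsub hx))
    have h3 : ∫ x in s..r, ‖u' x‖ = (r - s) * θ := by
      rw [intervalIntegral.integral_congr (g := fun _ => θ)]
      · simp
      · intro x hx
        rw [uIcc_of_le hsr] at hx
        exact hs x (hsub hx)
    rw [h3] at h2
    have habs := abs_le.1 ((abs_real_inner_le_norm (u s) (u r)).trans
      (by rw [h1 s (hsub ⟨le_rfl, hsr⟩), h1 r (hsub ⟨hsr, le_rfl⟩), one_mul]))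
    rw [← Real.cos_arccos habs.1 habs.2]
    refine Real.cos_le_cos_of_nonneg_of_le_pi (Real.arccos_nonneg _) ?_ h2
    nlinarith [Real.pi_pos]
  have hA := hlow 0 t le_rfl ht.1 ht.2
  have hB := hlow t 1 ht.1 ht.2 le_rfl
  rw [sub_zero] at hA
  have hn0 := h1 0 (by simp)
  have hnt := h1 t ht
  -- For `θ = 0` the orthogonality of `b` is not available, but the curve is constant.
  rcases h0.eq_or_lt with rfl | hpos
  · simp only [mul_zero, Real.cos_zero, Real.sin_zero, one_smul, zero_smul, add_zero] at hA ⊢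
    exact (eq_of_one_le_inner hn0 hnt hA).symm
  · have hb0 := hb hpos.ne'
    have hsin : 0 < Real.sin θ := Real.sin_pos_of_pos_of_lt_pi hpos (by linarith [Real.pi_pos])
    refine eq_of_one_le_inner hnt ?_ ?_
    · rw [← sq_eq_sq₀ (norm_nonneg _) zero_le_one, norm_add_sq_real, norm_smul, norm_smul, hn0, hb1,
        inner_smul_left, inner_smul_right, hb0, mul_one, mul_one, Real.norm_eq_abs,
        Real.norm_eq_abs, sq_abs, sq_abs]
      simp
    · rw [hend, inner_add_right, inner_smul_right, inner_smul_right, sub_mul, one_mul,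
        Real.cos_sub] at hB
      rw [inner_add_right, inner_smul_right, inner_smul_right]
      rw [real_inner_comm] at hA
      have hsc := Real.sin_sq_add_cos_sq (t * θ)
      have hsd : 0 ≤ Real.sin ((1 - t) * θ) := Real.sin_nonneg_of_nonneg_of_le_pi
        (mul_nonneg (by linarith [ht.2]) h0) (by nlinarith [ht.1, ht.2, Real.pi_pos])
      have hst : 0 ≤ Real.sin (t * θ) := Real.sin_nonneg_of_nonneg_of_le_pi
        (mul_nonneg ht.1 h0) (by nlinarith [ht.1, ht.2, Real.pi_pos])
      rw [sub_mul, one_mul, Real.sin_sub] at hsd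
      -- `sin θ` times the expected point is `sin ((1 - t) θ) • u 0 + sin (t θ) • u 1`. Pairing with
      -- `u t` and using the two bounds `hA`, `hB` gives at least `sin θ`, by the addition formula.
      refine le_of_mul_le_mul_left ?_ hsin
      set c := Real.cos (t * θ)
      set d := Real.sin (t * θ)
      have e1 := mul_le_mul_of_nonneg_left hA hsd
      have e2 := mul_le_mul_of_nonneg_left hB hst
      linear_combination e1 + e2 - Real.sin θ * hsc
end Sphere

/-! ### Columns as vectors of Euclidean space. -/

section Columns

variable {n p : ℕ}

/-- The `i`-th column of a matrix, as a continuous linear map to Euclidean space. -/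
noncomputable def colCLM (n : ℕ) {p : ℕ} (i : Fin p) : Mat n p →L[ℝ] EuclideanSpace ℝ (Fin n) :=
  LinearMap.toContinuousLinearMap
    { toFun := fun A => WithLp.toLp 2 fun k => A k i
      map_add' := fun _ _ => rfl
      map_smul' := fun _ _ => rfl }

lemma colCLM_apply (A : Mat n p) (i : Fin p) (k : Fin n) : colCLM n i A k = A k i := rfl

lemma inner_colCLM (A B : Mat n p) (i j : Fin p) :
    inner ℝ (colCLM n i A) (colCLM n j B) = (Aᵀ * B) i j := by
  rw [PiLp.inner_apply, Matrix.mul_apply]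
  exact Finset.sum_congr rfl fun k _ => by simp [colCLM_apply, mul_comm]

lemma sum_norm_colCLM_sq (A : Mat n p) : ∑ i, ‖colCLM n i A‖ ^ 2 = (Aᵀ * A).trace := by
  simp_rw [← real_inner_self_eq_norm_sq, inner_colCLM]
  rfl

lemma norm_colCLM {U : Mat n p} (hU : U ∈ Onb n p) (i : Fin p) : ‖colCLM n i U‖ = 1 := by
  rw [← sq_eq_sq₀ (norm_nonneg _) zero_le_one, ← real_inner_self_eq_norm_sq, inner_colCLM,
    show Uᵀ * U = 1 from hU]
  simp

lemma ext_colCLM {A B : Mat n p} (h : ∀ i, colCLM n i A = colCLM n i B) : A = B := by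
  ext k i
  exact congrArg (fun v : EuclideanSpace ℝ (Fin n) => v k) (h i)

end Columns

/-! ### The explicit geodesic and its minimality. -/

section Geodesic

variable {n p : ℕ}

/-- The horizontal geodesic from `a` with initial velocity `W diag(θ)`. -/
noncomputable def geodesic (a W : Mat n p) (θ : Fin p → ℝ) (t : ℝ) : Mat n p :=
  a * diagonal (fun i => Real.cos (t * θ i)) + W * diagonal (fun i => Real.sin (t * θ i))

/-- The velocity of `geodesic`. -/
noncomputable def geodesicVelocity (a W : Mat n p) (θ : Fin p → ℝ) (t : ℝ) : Mat n p :=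
  a * diagonal (fun i => -(θ i * Real.sin (t * θ i))) +
    W * diagonal (fun i => θ i * Real.cos (t * θ i))

lemma colCLM_geodesic (a W : Mat n p) (θ : Fin p → ℝ) (t : ℝ) (i : Fin p) :
    colCLM n i (geodesic a W θ t) =
      Real.cos (t * θ i) • colCLM n i a + Real.sin (t * θ i) • colCLM n i W := by
  ext k
  simp [colCLM_apply, geodesic, mul_comm]

lemma geodesic_zero (a W : Mat n p) (θ : Fin p → ℝ) : geodesic a W θ 0 = a := by
  simp [geodesic]

lemma geodesicVelocity_zero (a W : Mat n p) (θ : Fin p → ℝ) :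
    geodesicVelocity a W θ 0 = W * diagonal θ := by
  simp [geodesicVelocity]

lemma hasDerivAt_diagonal {f : ℝ → Fin p → ℝ} {f' : Fin p → ℝ} {t : ℝ}
    (h : ∀ i, HasDerivAt (fun t => f t i) (f' i) t) :
    HasDerivAt (fun t => (diagonal (f t) : Mat p p)) (diagonal f') t :=
  ((LinearMap.toContinuousLinearMap (Matrix.diagonalLinearMap (Fin p) ℝ ℝ)).hasFDerivAt
    (x := f t)).comp_hasDerivAt t (hasDerivAt_pi.2 h)

lemma hasDerivAt_geodesic (a W : Mat n p) (θ : Fin p → ℝ) (t : ℝ) :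
    HasDerivAt (geodesic a W θ) (geodesicVelocity a W θ t) t := by
  have hlin : ∀ i, HasDerivAt (fun t : ℝ => t * θ i) (θ i) t := fun i => by
    simpa using (hasDerivAt_id t).mul_const (θ i)
  have h1 : HasDerivAt (fun t => (diagonal (fun i => Real.cos (t * θ i)) : Mat p p))
      (diagonal fun i => -(θ i * Real.sin (t * θ i))) t :=
    hasDerivAt_diagonal fun i => ((Real.hasDerivAt_cos _).comp t (hlin i)).congr_deriv (by ring)
  have h2 : HasDerivAt (fun t => (diagonal (fun i => Real.sin (t * θ i)) : Mat p p))
      (diagonal fun i => θ i * Real.cos (t * θ i)) t :=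
    hasDerivAt_diagonal fun i => ((Real.hasDerivAt_sin _).comp t (hlin i)).congr_deriv (by ring)
  have h3 := ((mulCLM n p p a).hasFDerivAt (x := _)).comp_hasDerivAt t h1
  have h4 := ((mulCLM n p p W).hasFDerivAt (x := _)).comp_hasDerivAt t h2
  exact h3.add h4

lemma continuous_geodesicVelocity (a W : Mat n p) (θ : Fin p → ℝ) :
    Continuous (geodesicVelocity a W θ) := by
  unfold geodesicVelocity
  refine (continuous_const.matrix_mul (Continuous.matrix_diagonal (n := Fin p) (R := ℝ) ?_)).add
    (continuous_const.matrix_mul (Continuous.matrix_diagonal (n := Fin p) (R := ℝ) ?_)) <;> fun_prop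

variable {a W : Mat n p} {θ : Fin p → ℝ}

/-- In a thin singular value decomposition the columns of `W` at zero singular values need not be
orthogonal to `a`. Hence the hypothesis is weighted by `θ`, and `f` must vanish wherever `θ` does.
-/
lemma mul_diagonal_eq_zero (h : aᵀ * W * diagonal θ = 0) {f : Fin p → ℝ}
    (hf : ∀ i, θ i = 0 → f i = 0) : aᵀ * (W * diagonal f) = 0 := by
  ext i j
  have hij := congrFun (congrFun h i) j
  rw [Matrix.mul_diagonal, Matrix.zero_apply] at hij
  rw [← Matrix.mul_assoc, Matrix.mul_diagonal, Matrix.zero_apply]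
  rcases mul_eq_zero.1 hij with h0 | h0
  · rw [h0, zero_mul]
  · rw [hf j h0, mul_zero]

/-- The one computation behind orthonormality, horizontality and constant speed of the geodesic. -/
lemma combination_mul_combination (ha : aᵀ * a = 1) (hW : Wᵀ * W = 1)
    (h : aᵀ * W * diagonal θ = 0) (c c' : Fin p → ℝ) {s s' : Fin p → ℝ}
    (hs : ∀ i, θ i = 0 → s i = 0) (hs' : ∀ i, θ i = 0 → s' i = 0) :
    (a * diagonal c + W * diagonal s)ᵀ * (a * diagonal c' + W * diagonal s') =
      diagonal fun i => c i * c' i + s i * s' i := by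
  have h1 : aᵀ * (W * diagonal s') = 0 := mul_diagonal_eq_zero h hs'
  have h2 : (W * diagonal s)ᵀ * a = 0 := by
    rw [← transpose_transpose a, ← transpose_mul, mul_diagonal_eq_zero h hs, transpose_zero]
  have e1 : (a * diagonal c)ᵀ * (a * diagonal c') = diagonal fun i => c i * c' i := by
    rw [transpose_mul, Matrix.mul_assoc, ← Matrix.mul_assoc aᵀ, ha, Matrix.one_mul,
      diagonal_transpose, diagonal_mul_diagonal]
  have e2 : (W * diagonal s)ᵀ * (W * diagonal s') = diagonal fun i => s i * s' i := by
    rw [transpose_mul, Matrix.mul_assoc, ← Matrix.mul_assoc Wᵀ, hW, Matrix.one_mul,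
      diagonal_transpose, diagonal_mul_diagonal]
  have e3 : (a * diagonal c)ᵀ * (W * diagonal s') = 0 := by
    rw [transpose_mul, Matrix.mul_assoc, h1, Matrix.mul_zero]
  have e4 : (W * diagonal s)ᵀ * (a * diagonal c') = 0 := by
    rw [← Matrix.mul_assoc, h2, Matrix.zero_mul]
  rw [transpose_add, Matrix.add_mul, Matrix.mul_add, Matrix.mul_add, e1, e2, e3, e4, add_zero,
    zero_add, diagonal_add]

lemma geodesic_mem_onb (ha : aᵀ * a = 1) (hW : Wᵀ * W = 1) (h : aᵀ * W * diagonal θ = 0)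
    (t : ℝ) : geodesic a W θ t ∈ Onb n p := by
  show (geodesic a W θ t)ᵀ * geodesic a W θ t = 1
  rw [geodesic, combination_mul_combination ha hW h _ _ (fun i hi => by simp [hi])
    (fun i hi => by simp [hi]), ← diagonal_one]
  congr 1
  ext i
  have := Real.cos_sq_add_sin_sq (t * θ i)
  rw [← this]; ring

lemma geodesic_mul_velocity (ha : aᵀ * a = 1) (hW : Wᵀ * W = 1) (h : aᵀ * W * diagonal θ = 0)
    (t : ℝ) : (geodesic a W θ t)ᵀ * geodesicVelocity a W θ t = 0 := by
  rw [geodesic, geodesicVelocity, combination_mul_combination ha hW h _ _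
    (fun i hi => by simp [hi]) (fun i hi => by simp [hi]), ← diagonal_zero]
  congr 1
  ext i
  ring

lemma trace_geodesicVelocity (ha : aᵀ * a = 1) (hW : Wᵀ * W = 1)
    (h : aᵀ * W * diagonal θ = 0) (t : ℝ) :
    ((geodesicVelocity a W θ t)ᵀ * geodesicVelocity a W θ t).trace = ∑ i, θ i ^ 2 := by
  rw [geodesicVelocity, combination_mul_combination ha hW h _ _
    (fun i hi => by simp [hi]) (fun i hi => by simp [hi]), trace_diagonal]
  refine Finset.sum_congr rfl fun i _ => ?_
  linear_combination θ i ^ 2 * Real.cos_sq_add_sin_sq (t * θ i)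

lemma transpose_geodesic_mul (ha : aᵀ * a = 1) (h : aᵀ * W * diagonal θ = 0) (t : ℝ) :
    aᵀ * geodesic a W θ t = diagonal fun i => Real.cos (t * θ i) := by
  rw [geodesic, Matrix.mul_add, ← Matrix.mul_assoc, ha, Matrix.one_mul,
    mul_diagonal_eq_zero h (fun i hi => by simp [hi]), add_zero]

lemma velocity_geodesic {t : ℝ} (ht : t ∈ Icc (0 : ℝ) 1) :
    velocity (geodesic a W θ) t = geodesicVelocity a W θ t :=
  HasDerivWithinAt.velocity_eq (hasDerivAt_geodesic a W θ t).hasDerivWithinAt ht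

lemma isOnbCurve_geodesic (ha : aᵀ * a = 1) (hW : Wᵀ * W = 1) (h : aᵀ * W * diagonal θ = 0) :
    IsOnbCurve a (geodesic a W θ 1) (geodesic a W θ) :=
  ⟨contDiffOn_of_hasDerivWithinAt
    (fun t _ => (hasDerivAt_geodesic a W θ t).hasDerivWithinAt)
    (continuous_geodesicVelocity a W θ).continuousOn,
    fun t _ => geodesic_mem_onb ha hW h t, geodesic_zero a W θ,
    samePoint_of_tau_eq (geodesic_mem_onb ha hW h 1) rfl⟩

lemma onbSpeed_of_horizontal {γ : ℝ → Mat n p} {t : ℝ} (h : (γ t)ᵀ * velocity γ t = 0) :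
    onbSpeed γ t = √(((velocity γ t)ᵀ * velocity γ t).trace) := by
  have e : horPart (γ t) (velocity γ t) = velocity γ t := by
    rw [horPart, Matrix.sub_mul, Matrix.mul_assoc, h]; simp
  rw [onbSpeed, e, onbMetric_of_horizontal h]

lemma onbSpeed_geodesic (ha : aᵀ * a = 1) (hW : Wᵀ * W = 1) (h : aᵀ * W * diagonal θ = 0)
    {t : ℝ} (ht : t ∈ Icc (0 : ℝ) 1) : onbSpeed (geodesic a W θ) t = √(∑ i, θ i ^ 2) := by
  rw [onbSpeed_of_horizontal (by rw [velocity_geodesic ht, geodesic_mul_velocity ha hW h]),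
    velocity_geodesic ht, trace_geodesicVelocity ha hW h]

/-- The columns of a curve of orthonormal bases which ends at the point of `geodesic a W θ 1`
are at least as long as the arcs traced by the columns of the geodesic. -/
lemma le_integral_norm_col (ha : aᵀ * a = 1) (hW : Wᵀ * W = 1) (h : aᵀ * W * diagonal θ = 0)
    (hθ : ∀ i, 0 ≤ θ i ∧ θ i < Real.pi / 2) {γ : ℝ → Mat n p}
    (hγ : ContDiffOn ℝ 1 γ (Icc 0 1)) (ho : ∀ t ∈ Icc (0 : ℝ) 1, γ t ∈ Onb n p) (h0 : γ 0 = a)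
    (h1 : SamePoint (geodesic a W θ 1) (γ 1)) (i : Fin p) :
    θ i ≤ ∫ t in (0 : ℝ)..1, ‖colCLM n i (velocity γ t)‖ ∧
      (∫ t in (0 : ℝ)..1, ‖colCLM n i (velocity γ t)‖ ≤ θ i →
        colCLM n i (γ 1) = colCLM n i (geodesic a W θ 1)) := by
  obtain ⟨S, -, hS⟩ := h1
  have hg := geodesic_mem_onb ha hW h 1
  have hγ1 := ho 1 (by simp)
  have hcos : 0 < Real.cos (θ i) :=
    Real.cos_pos_of_mem_Ioo ⟨by linarith [(hθ i).1, Real.pi_pos], (hθ i).2⟩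
  have hpi : θ i ≤ Real.pi := by linarith [(hθ i).2, Real.pi_pos]
  -- As `γ 1` is the end of the geodesic times an orthogonal `S`, this inner product is `cos θᵢ Sᵢᵢ
  -- ≤ cos θᵢ`. Equality forces `Sᵢᵢ = 1` because `cos θᵢ > 0`, which is where `θᵢ < π / 2` matters.
  have hk : inner ℝ (colCLM n i (γ 0)) (colCLM n i (γ 1)) = Real.cos (θ i) * S i i := by
    rw [inner_colCLM, h0, hS, ← Matrix.mul_assoc, transpose_geodesic_mul ha h,
      Matrix.diagonal_mul, one_mul]
  have hSi : inner ℝ (colCLM n i (geodesic a W θ 1)) (colCLM n i (γ 1)) = S i i := by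
    rw [inner_colCLM, hS, ← Matrix.mul_assoc, show (geodesic a W θ 1)ᵀ * geodesic a W θ 1 = 1 from hg,
      Matrix.one_mul]
  have hSle : S i i ≤ 1 := by
    rw [← hSi]
    refine (real_inner_le_norm _ _).trans ?_
    rw [norm_colCLM hg, norm_colCLM hγ1, one_mul]
  have harc := arccos_inner_le_integral (u := fun t => colCLM n i (γ t))
    (u' := fun t => colCLM n i (velocity γ t)) zero_le_one
    (fun r hr => ((colCLM n i).hasFDerivAt (x := γ r)).comp_hasDerivWithinAt r
      (hasDerivWithinAt_velocity hγ hr))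
    ((colCLM n i).continuous.comp_continuousOn (continuousOn_velocity hγ))
    (fun r hr => norm_colCLM (ho r hr) i)
  have habs := abs_le.1 ((abs_real_inner_le_norm (colCLM n i (γ 0)) (colCLM n i (γ 1))).trans
    (by rw [norm_colCLM (ho 0 (by simp)), norm_colCLM hγ1, one_mul]))
  rw [hk] at harc habs
  constructor
  · refine le_trans ?_ harc
    rw [← Real.arccos_cos (hθ i).1 hpi]
    exact Real.arccos_le_arccos (by rw [Real.arccos_cos (hθ i).1 hpi]; nlinarith)
  · intro hle
    have h2 := Real.cos_le_cos_of_nonneg_of_le_pi (Real.arccos_nonneg _) hpi (harc.trans hle)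
    rw [Real.cos_arccos habs.1 habs.2] at h2
    refine (eq_of_one_le_inner (norm_colCLM hg i) (norm_colCLM hγ1 i) ?_).symm
    rw [hSi]
    exact le_of_mul_le_mul_left (by simpa using h2) hcos

variable {δ : ℝ → Mat n n}

/-- The geodesic is shortest, and is the only shortest curve of constant speed. -/
lemma length_geodesic_le (ha : aᵀ * a = 1) (hW : Wᵀ * W = 1) (h : aᵀ * W * diagonal θ = 0)
    (hθ : ∀ i, 0 ≤ θ i ∧ θ i < Real.pi / 2)
    (hδ : IsGrCurve p (tau a) (tau (geodesic a W θ 1)) δ) :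
    √(∑ i, θ i ^ 2) ≤ length (grSpeed δ) ∧
      ((∃ c, ∀ t ∈ Icc (0 : ℝ) 1, grSpeed δ t = c) → length (grSpeed δ) ≤ √(∑ i, θ i ^ 2) →
        ∀ t ∈ Icc (0 : ℝ) 1, δ t = tau (geodesic a W θ t)) := by
  obtain ⟨γ, hγ, ho, hγ0, hτ, hhor⟩ := hδ.exists_lift (U := a) ha rfl
  have hend : SamePoint (geodesic a W θ 1) (γ 1) :=
    samePoint_of_tau_eq (ho 1 (by simp)) ((hτ 1 (by simp)).trans hδ.2.2.2).symm
  set N := √(∑ i, θ i ^ 2)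
  have hN2 : N ^ 2 = ∑ i, θ i ^ 2 := Real.sq_sqrt (Finset.sum_nonneg fun i _ => sq_nonneg _)
  have hN0 : 0 ≤ N := Real.sqrt_nonneg _
  let v : Fin p → ℝ → ℝ := fun i t => ‖colCLM n i (velocity γ t)‖
  have hvc : ∀ i, ContinuousOn (v i) (Icc 0 1) := fun i =>
    ((colCLM n i).continuous.comp_continuousOn (continuousOn_velocity hγ)).norm
  have hvi : ∀ i, IntervalIntegrable (v i) MeasureTheory.volume 0 1 := fun i =>
    (hvc i).intervalIntegrable_of_Icc zero_le_one
  have hspeed : ∀ t ∈ Icc (0 : ℝ) 1, grSpeed δ t = √(∑ i, v i t ^ 2) := fun t ht => by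
    rw [← grSpeed_congr hτ ht, grSpeed_tau hγ ho ht, onbSpeed_of_horizontal (hhor t ht),
      sum_norm_colCLM_sq]
  have hsc : ContinuousOn (fun t => √(∑ i, v i t ^ 2)) (Icc 0 1) :=
    (continuousOn_finsetSum _ fun i _ => (hvc i).pow 2).sqrt
  have hlen : length (grSpeed δ) = ∫ t in (0 : ℝ)..1, √(∑ i, v i t ^ 2) := length_congr hspeed
  have hcol := le_integral_norm_col ha hW h hθ hγ ho hγ0 hend
  -- The chain is `N² ≤ ∑ θᵢ ∫ vᵢ ≤ N * length`, the second inequality being Cauchy–Schwarz at each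
  -- time.
  have hlow : N ^ 2 ≤ ∑ i, θ i * ∫ t in (0 : ℝ)..1, v i t := by
    rw [hN2]
    refine Finset.sum_le_sum fun i _ => ?_
    rw [sq]
    exact mul_le_mul_of_nonneg_left (hcol i).1 (hθ i).1
  have hsum : ∑ i, θ i * ∫ t in (0 : ℝ)..1, v i t = ∫ t in (0 : ℝ)..1, ∑ i, θ i * v i t := by
    rw [intervalIntegral.integral_finsetSum fun i _ => (hvi i).const_mul _]
    simp
  have hcs : ∫ t in (0 : ℝ)..1, ∑ i, θ i * v i t ≤ N * length (grSpeed δ) := by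
    rw [hlen, ← intervalIntegral.integral_const_mul]
    refine intervalIntegral.integral_mono_on zero_le_one ?_
      ((hsc.intervalIntegrable_of_Icc zero_le_one).const_mul _) fun t _ => ?_
    · exact (continuousOn_finsetSum _ fun i _ => continuousOn_const.mul (hvc i)
        ).intervalIntegrable_of_Icc zero_le_one
    · exact Real.sum_mul_le_sqrt_mul_sqrt _ _ _
  have hlen0 : 0 ≤ length (grSpeed δ) := by
    rw [hlen]
    exact intervalIntegral.integral_nonneg zero_le_one fun t _ => Real.sqrt_nonneg _
  refine ⟨?_, ?_⟩
  · rcases hN0.eq_or_lt with h0 | hpos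
    · rw [← h0]; exact hlen0
    · refine le_of_mul_le_mul_left ?_ hpos
      rw [← sq]
      exact hlow.trans (hsum.trans_le hcs)
  · rintro ⟨c, hc⟩ hle
    have hlc : length (grSpeed δ) = c := by
      rw [length_congr hc]; simp [length]
    have hc0 : 0 ≤ c := hlc ▸ hlen0
    have hcN : c ≤ N := hlc ▸ hle
    have hvsq : ∀ t ∈ Icc (0 : ℝ) 1, ∑ i, v i t ^ 2 = c ^ 2 := fun t ht => by
      rw [← hc t ht, hspeed t ht, Real.sq_sqrt (Finset.sum_nonneg fun i _ => sq_nonneg _)]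
    have hdefc : ContinuousOn (fun t => ∑ i, (v i t - θ i) ^ 2) (Icc 0 1) :=
      continuousOn_finsetSum _ fun i _ => ((hvc i).sub continuousOn_const).pow 2
    -- By `hlow` and `c ≤ N` this value is at most `c² - N² ≤ 0`, so the nonnegative continuous
    -- integrand vanishes and every column has speed `θᵢ`.
    have hint : ∫ t in (0 : ℝ)..1, ∑ i, (v i t - θ i) ^ 2 =
        c ^ 2 + N ^ 2 - 2 * ∑ i, θ i * ∫ t in (0 : ℝ)..1, v i t := by
      rw [hsum, intervalIntegral.integral_congr
        (g := fun t => (c ^ 2 + N ^ 2) - 2 * ∑ i, θ i * v i t)]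
      · rw [intervalIntegral.integral_sub (by simp), intervalIntegral.integral_const_mul]
        · simp
        · exact (((continuousOn_finsetSum _ fun i _ => continuousOn_const.mul (hvc i)
            ).intervalIntegrable_of_Icc zero_le_one)).const_mul _
      · intro t ht
        rw [uIcc_of_le zero_le_one] at ht
        simp only
        rw [← hvsq t ht, hN2, Finset.mul_sum, ← Finset.sum_add_distrib, ← Finset.sum_sub_distrib]
        exact Finset.sum_congr rfl fun i _ => by ring
    have hzero : ∀ t ∈ Icc (0 : ℝ) 1, ∑ i, (v i t - θ i) ^ 2 = 0 := by
      by_contra hne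
      push Not at hne
      obtain ⟨t, ht, hne⟩ := hne
      have hpos := intervalIntegral.integral_pos zero_lt_one hdefc
        (fun s _ => Finset.sum_nonneg fun i _ => sq_nonneg _)
        ⟨t, ht, (Finset.sum_nonneg fun i _ => sq_nonneg _).lt_of_ne' hne⟩
      rw [hint] at hpos
      nlinarith
    have hv : ∀ i, ∀ t ∈ Icc (0 : ℝ) 1, v i t = θ i := fun i t ht => by
      have := (Finset.sum_eq_zero_iff_of_nonneg fun i _ => sq_nonneg _).1 (hzero t ht) i
        (Finset.mem_univ i)
      exact sub_eq_zero.1 (pow_eq_zero_iff two_ne_zero |>.1 this)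
    intro t ht
    rw [← hτ t ht]
    congr 1
    refine ext_colCLM fun i => ?_
    have hl : ∫ t in (0 : ℝ)..1, v i t = θ i := by
      rw [intervalIntegral.integral_congr (g := fun _ => θ i)]
      · simp
      · intro s hs
        rw [uIcc_of_le zero_le_one] at hs
        exact hv i s hs
    have h1i := (hcol i).2 hl.le
    have hcirc := eq_great_circle (u := fun t => colCLM n i (γ t))
      (u' := fun t => colCLM n i (velocity γ t)) (b := colCLM n i W) (hθ i).1 (hθ i).2
      (fun r hr => ((colCLM n i).hasFDerivAt (x := γ r)).comp_hasDerivWithinAt r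
        (hasDerivWithinAt_velocity hγ hr))
      ((colCLM n i).continuous.comp_continuousOn (continuousOn_velocity hγ))
      (fun r hr => norm_colCLM (ho r hr) i) (hv i)
      (fun hne => by
        have hii := congrFun (congrFun h i) i
        rw [Matrix.mul_diagonal, Matrix.zero_apply] at hii
        rw [hγ0, inner_colCLM]
        exact (mul_eq_zero.1 hii).resolve_right hne)
      (norm_colCLM (U := W) hW i)
      (by rw [h1i, colCLM_geodesic, one_mul, hγ0]) t ht
    rw [colCLM_geodesic, ← hγ0]
    exact hcirc

/-- The logarithm, in the projector perspective, of the end point of the geodesic. -/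
lemma isGrLog_geodesic (ha : aᵀ * a = 1) (hW : Wᵀ * W = 1) (h : aᵀ * W * diagonal θ = 0)
    (hθ : ∀ i, 0 ≤ θ i ∧ θ i < Real.pi / 2) :
    IsGrLog p (tau a) (tau (geodesic a W θ 1))
      (a * (W * diagonal θ)ᵀ + W * diagonal θ * aᵀ) := by
  have hcurve := isOnbCurve_geodesic ha hW h
  have hs : ∀ t ∈ Icc (0 : ℝ) 1, grSpeed (fun t => tau (geodesic a W θ t)) t =
      √(∑ i, θ i ^ 2) := fun t ht => by
    rw [grSpeed_tau hcurve.1 hcurve.2.1 ht, onbSpeed_geodesic ha hW h ht]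
  have hl : length (grSpeed fun t => tau (geodesic a W θ t)) = √(∑ i, θ i ^ 2) := by
    rw [length_congr hs]; simp [length]
  refine ⟨_, ⟨hcurve.isGrCurve, ⟨_, hs⟩, fun ε hε => ?_⟩, ?_, fun ε hε => ?_⟩
  · rw [hl]
    exact (length_geodesic_le ha hW h hθ hε).1
  · have hv : velocity (geodesic a W θ) 0 = W * diagonal θ := by
      rw [velocity_geodesic (by simp), geodesicVelocity_zero]
    have hh : horPart a (W * diagonal θ) = W * diagonal θ := by
      rw [horPart, Matrix.sub_mul, Matrix.mul_assoc, ← Matrix.mul_assoc aᵀ, h]; simp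
    rw [hcurve.velocity_tau_zero, hv, hh]
  · exact (length_geodesic_le ha hW h hθ hε.1).2 hε.2.1 (hl ▸ hε.2.2 _ hcurve.isGrCurve)

end Geodesic

/-! ### Existence of thin singular value decompositions. -/

section SVD

variable {n p : ℕ}

/-- Diagonalizing `Mᵀ M` by `Z` makes the columns of `M Z` orthogonal with norms `σ i`. The nonzero
ones are normalized, and `p ≤ n` leaves room to complete them orthonormally. -/
lemma exists_thinSVD (hpn : p ≤ n) (M : Mat n p) : ∃ W σ Z, IsThinSVD M W σ Z := by
  have hps : (Mᴴ * M).PosSemidef := Matrix.posSemidef_conjTranspose_mul_self M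
  have hH : (Mᴴ * M).IsHermitian := hps.1
  set Z : Mat p p := hH.eigenvectorUnitary.1 with hZdef
  have hZ : Z ∈ Matrix.orthogonalGroup (Fin p) ℝ := hH.eigenvectorUnitary.2
  have hZZ : Z * Zᵀ = 1 := (Matrix.mem_orthogonalGroup_iff _ _).1 hZ
  let σ : Fin p → ℝ := fun i => √(hH.eigenvalues i)
  have hσ2 : ∀ i, σ i ^ 2 = hH.eigenvalues i := fun i => Real.sq_sqrt (hps.eigenvalues_nonneg i)
  have hN : (M * Z)ᵀ * (M * Z) = diagonal fun i => σ i ^ 2 := by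
    have h := hH.conjStarAlgAut_star_eigenvectorUnitary
    rw [Unitary.conjStarAlgAut_apply] at h
    have h2 : Zᵀ * (Mᵀ * M) * Z = diagonal hH.eigenvalues := by
      simpa [Matrix.star_eq_conjTranspose, Function.comp_def, hZdef] using h
    simp_rw [hσ2]
    rw [← h2, transpose_mul]
    simp only [Matrix.mul_assoc]
  have hcol : ∀ i j, inner ℝ (colCLM n i (M * Z)) (colCLM n j (M * Z)) =
      if i = j then σ i ^ 2 else 0 := fun i j => by
    rw [inner_colCLM, hN, Matrix.diagonal_apply]
  -- Indexing by `Fin n` allows extension to a basis of the whole space. Only the values on `s` are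
  -- used, so the default `0` is harmless.
  let v : Fin n → EuclideanSpace ℝ (Fin n) := fun k =>
    if h : k.1 < p then (σ ⟨k, h⟩)⁻¹ • colCLM n ⟨k, h⟩ (M * Z) else 0
  have hv : ∀ i : Fin p, v (Fin.castLE hpn i) = (σ i)⁻¹ • colCLM n i (M * Z) := fun i => by
    simp [v]
  let s : Set (Fin n) := Fin.castLE hpn '' {i | σ i ≠ 0}
  have hs : Orthonormal ℝ (s.domRestrict v) := by
    rw [orthonormal_iff_ite]
    rintro ⟨_, i, hi, rfl⟩ ⟨_, j, hj, rfl⟩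
    simp only [Set.domRestrict_apply, hv, inner_smul_left, inner_smul_right, hcol]
    by_cases hij : i = j
    · subst hij
      have : σ i ≠ 0 := hi
      simp only [if_true, conj_trivial]
      field_simp
    · rw [if_neg hij, if_neg fun h => hij (Fin.castLE_injective hpn (Subtype.ext_iff.1 h))]
      simp
  obtain ⟨b, hb⟩ := hs.exists_orthonormalBasis_extension_of_card_eq (by simp)
  let W : Mat n p := Matrix.of fun k i => b (Fin.castLE hpn i) k
  have hWcol : ∀ i, colCLM n i W = b (Fin.castLE hpn i) := fun i => rfl
  refine ⟨W, σ, Z, ?_, hZ, fun i => Real.sqrt_nonneg _, ?_⟩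
  · ext i j
    rw [← inner_colCLM, hWcol, hWcol, orthonormal_iff_ite.1 b.orthonormal, Matrix.one_apply]
    simp [(Fin.castLE_injective hpn).eq_iff]
  · have hMZ : M * Z = W * diagonal σ := by
      refine ext_colCLM fun i => ?_
      have e : colCLM n i (W * diagonal σ) = σ i • colCLM n i W := by
        ext k
        simp [colCLM_apply, mul_comm]
      rw [e, hWcol]
      by_cases hi : σ i = 0
      · rw [hi, zero_smul, ← norm_eq_zero, ← sq_eq_zero_iff, ← real_inner_self_eq_norm_sq, hcol]
        simp [hi]
      · rw [hb _ ⟨i, hi, rfl⟩, hv, smul_inv_smul₀ hi]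
    rw [← hMZ, Matrix.mul_assoc, hZZ, Matrix.mul_one]

lemma le_of_mem_onb {U : Mat n p} (hU : U ∈ Onb n p) : p ≤ n := by
  have h := Matrix.rank_le_height U
  rw [← Matrix.rank_transpose_mul_self, show Uᵀ * U = 1 from hU, Matrix.rank_one,
    Fintype.card_fin] at h
  exact h

end SVD

/-! ### Uniqueness of the principal logarithm. -/

section ComplexExp

variable {n : ℕ}

lemma hasSum_exp_mulVec (T : Matrix (Fin n) (Fin n) ℂ) (x : Fin n → ℂ) :
    HasSum (fun k : ℕ => ((k.factorial : ℂ)⁻¹ • T ^ k) *ᵥ x) (NormedSpace.exp T *ᵥ x) := by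
  have h : Continuous fun A : Matrix (Fin n) (Fin n) ℂ => A *ᵥ x :=
    continuous_id.matrix_mulVec continuous_const
  exact (NormedSpace.exp_series_hasSum_exp' (𝕂 := ℂ) T).map
    (AddMonoidHom.mk' (fun A : Matrix (Fin n) (Fin n) ℂ => A *ᵥ x) fun A B => add_mulVec A B x) h

lemma exp_mulVec_of_eigenvector {T : Matrix (Fin n) (Fin n) ℂ} {x : Fin n → ℂ} {μ : ℂ}
    (h : T *ᵥ x = μ • x) : NormedSpace.exp T *ᵥ x = Complex.exp μ • x := by
  have hpow : ∀ k : ℕ, T ^ k *ᵥ x = μ ^ k • x := by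
    intro k
    induction k with
    | zero => simp
    | succ k ih =>
      rw [pow_succ, ← mulVec_mulVec, h, mulVec_smul, ih, smul_smul, pow_succ, mul_comm]
  refine (hasSum_exp_mulVec T x).unique ?_
  have h2 := (NormedSpace.exp_series_hasSum_exp' (𝕂 := ℂ) μ).smul_const x
  rw [← Complex.exp_eq_exp_ℂ] at h2
  refine h2.congr_fun fun k => ?_
  rw [smul_mulVec, hpow, smul_smul, smul_eq_mul]

lemma exp_mulVec_of_sq_mulVec_eq_zero {T : Matrix (Fin n) (Fin n) ℂ} {x : Fin n → ℂ}
    (h : T *ᵥ T *ᵥ x = 0) : NormedSpace.exp T *ᵥ x = x + T *ᵥ x := by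
  refine (hasSum_exp_mulVec T x).unique ?_
  have h2 : HasSum (fun k : ℕ => ((k.factorial : ℂ)⁻¹ • T ^ k) *ᵥ x)
      (∑ k ∈ Finset.range 2, ((k.factorial : ℂ)⁻¹ • T ^ k) *ᵥ x) := by
    refine hasSum_sum_of_ne_finset_zero fun k hk => ?_
    obtain ⟨m, rfl⟩ : ∃ m, k = m + 2 := ⟨k - 2, by simp at hk; omega⟩
    rw [smul_mulVec, pow_add, sq, ← mulVec_mulVec, ← mulVec_mulVec, h, mulVec_zero, smul_zero]
  simpa [Finset.sum_range_succ] using h2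

/-- If the eigenvalues of `T` lie in the strip `|Im z| < 2π`, then `exp T` fixes only the kernel
of `T`. -/
lemma mulVec_eq_zero_of_exp_mulVec {T : Matrix (Fin n) (Fin n) ℂ}
    (hT : ∀ z ∈ spectrum ℂ T, |z.im| < 2 * Real.pi) {x : Fin n → ℂ}
    (hx : NormedSpace.exp T *ᵥ x = x) : T *ᵥ x = 0 := by
  let f : Module.End ℂ (Fin n → ℂ) := Matrix.toLin' T
  -- `T` preserves the fixed space `K` of `exp T`. A nonzero eigenvalue there would be a nonzero
  -- multiple of `2πi`, which the strip excludes, so `T` is nilpotent on `K`.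
  let K : Submodule ℂ (Fin n → ℂ) := Module.End.eigenspace (Matrix.toLin' (NormedSpace.exp T)) 1
  have hK : ∀ y, y ∈ K ↔ NormedSpace.exp T *ᵥ y = y := fun y => by
    simp [K]
  have hcomm : Commute T (NormedSpace.exp T) := (Commute.refl T).exp_right
  have hfK : ∀ y ∈ K, f y ∈ K := fun y hy => by
    rw [hK] at hy ⊢
    rw [Matrix.toLin'_apply, mulVec_mulVec, ← hcomm.eq, ← mulVec_mulVec, hy]
  let g : Module.End ℂ K := f.restrict hfK
  have hg : ∀ y : K, ((g y : K) : Fin n → ℂ) = T *ᵥ (y : Fin n → ℂ) := fun y => rfl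
  have hbot : ∀ μ : ℂ, μ ≠ 0 → g.maxGenEigenspace μ = ⊥ := by
    intro μ hμ
    have hinj : Function.Injective (g - μ • (1 : Module.End ℂ K)) := by
      rw [injective_iff_map_eq_zero]
      intro y hy
      by_contra hy0
      have hTy : T *ᵥ (y : Fin n → ℂ) = μ • (y : Fin n → ℂ) := by
        rw [← hg]
        have := sub_eq_zero.1 hy
        rw [this]; rfl
      have hyne : (y : Fin n → ℂ) ≠ 0 := fun h => hy0 (Subtype.ext h)
      have hspec : μ ∈ spectrum ℂ T := by
        rw [← Matrix.spectrum_toLin', ← Module.End.hasEigenvalue_iff_mem_spectrum]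
        exact Module.End.hasEigenvalue_of_hasEigenvector
          ⟨Module.End.mem_eigenspace_iff.2 (by simpa using hTy), hyne⟩
      have hexp : Complex.exp μ • (y : Fin n → ℂ) = (1 : ℂ) • (y : Fin n → ℂ) := by
        rw [← exp_mulVec_of_eigenvector hTy, (hK y).1 y.2, one_smul]
      obtain ⟨k, hk⟩ := Complex.exp_eq_one_iff.1 (smul_left_injective ℂ hyne hexp)
      have him := hT μ hspec
      have him2 : μ.im = k * (2 * Real.pi) := by rw [hk]; simp
      have hk0 : k = 0 := by
        rw [him2, abs_mul, abs_of_pos Real.two_pi_pos] at him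
        have : |(k : ℝ)| < 1 := by
          by_contra hge
          nlinarith [Real.two_pi_pos]
        exact Int.abs_lt_one_iff.1 (by exact_mod_cast this)
      exact hμ (by rw [hk, hk0]; simp)
    rw [Submodule.eq_bot_iff]
    intro y hy
    obtain ⟨k, hk⟩ := (Module.End.mem_maxGenEigenspace _ _ _).1 hy
    have := hinj.iterate k
    rw [← Module.End.coe_pow] at this
    exact this (by rw [hk, map_zero])
  have htop : g.maxGenEigenspace 0 = ⊤ := by
    rw [eq_top_iff, ← Module.End.iSup_maxGenEigenspace_eq_top g]
    refine iSup_le fun μ => ?_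
    rcases eq_or_ne μ 0 with rfl | hμ
    · exact le_rfl
    · rw [hbot μ hμ]; exact bot_le
  -- If `T² y = 0`, the exponential series gives `y = exp T y = y + T y`. Iterating, nilpotency on
  -- `K` improves to vanishing.
  have hstep : ∀ y : K, g (g y) = 0 → g y = 0 := fun y hy => by
    have h1 : T *ᵥ T *ᵥ (y : Fin n → ℂ) = 0 := by
      rw [← hg, ← hg, hy]; rfl
    have h2 := exp_mulVec_of_sq_mulVec_eq_zero h1
    rw [(hK y).1 y.2] at h2
    exact Subtype.ext (left_eq_add.1 h2)
  have hpow : ∀ (k : ℕ) (y : K), (g ^ k) y = 0 → g y = 0 := by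
    intro k
    induction k with
    | zero => intro y hy; rw [pow_zero, Module.End.one_apply] at hy; rw [hy, map_zero]
    | succ k ih =>
      intro y hy
      rw [pow_succ, Module.End.mul_apply] at hy
      exact hstep y (ih _ hy)
  obtain ⟨k, hk⟩ := (Module.End.mem_maxGenEigenspace g 0 ⟨x, (hK x).2 hx⟩).1 (htop ▸ Submodule.mem_top)
  have hg0 : g - (0 : ℂ) • (1 : Module.End ℂ K) = g := LinearMap.ext fun y => by
    rw [LinearMap.sub_apply, LinearMap.smul_apply, zero_smul, sub_zero]
  rw [hg0] at hk
  exact congrArg Subtype.val (hpow k _ hk)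

/-- The exponential is injective on matrices with eigenvalues in the strip `|Im z| < π`, provided
one of them is skew-Hermitian. -/
lemma eq_of_exp_eq {A B : Matrix (Fin n) (Fin n) ℂ} (hB : Bᴴ = -B)
    (hA' : ∀ z ∈ spectrum ℂ A, |z.im| < Real.pi) (hB' : ∀ z ∈ spectrum ℂ B, |z.im| < Real.pi)
    (h : NormedSpace.exp A = NormedSpace.exp B) : A = B := by
  -- As `i B` is Hermitian, `B` has an orthonormal eigenbasis, on which it suffices to compare `A`
  -- and `B`.
  have hH : (Complex.I • B).IsHermitian := by
    rw [Matrix.IsHermitian, conjTranspose_smul, hB]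
    simp
  apply Matrix.toEuclideanLin.injective
  refine hH.eigenvectorBasis.toBasis.ext fun j => ?_
  set x : Fin n → ℂ := (hH.eigenvectorBasis j).ofLp with hxdef
  have hx0 : x ≠ 0 := fun h0 => hH.eigenvectorBasis.orthonormal.ne_zero j (by
    ext i; exact congrFun h0 i)
  set μ : ℂ := -Complex.I * hH.eigenvalues j with hμ
  have hBx : B *ᵥ x = μ • x := by
    have h1 := hH.mulVec_eigenvectorBasis j
    rw [smul_mulVec] at h1
    have h2 := congrArg (fun y => -Complex.I • y) h1
    simp only [smul_smul] at h2
    rw [neg_mul, Complex.I_mul_I, neg_neg, one_smul] at h2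
    rw [h2, hμ, mul_smul]
    rfl
  have hμspec : μ ∈ spectrum ℂ B := by
    rw [← Matrix.spectrum_toLin', ← Module.End.hasEigenvalue_iff_mem_spectrum]
    exact Module.End.hasEigenvalue_of_hasEigenvector
      ⟨Module.End.mem_eigenspace_iff.2 (by simpa using hBx), hx0⟩
  -- The shift by `-μ` turns the eigenvector into a fixed vector of the exponential; two imaginary
  -- parts below `π` differ by less than `2π`, as `mulVec_eq_zero_of_exp_mulVec` requires.
  have hexp : NormedSpace.exp (A + (-μ) • 1) *ᵥ x = x := by
    rw [Matrix.exp_add_of_commute _ _ ((Commute.one_right A).smul_right _), ← mulVec_mulVec,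
      exp_mulVec_of_eigenvector (T := (-μ) • 1) (μ := -μ) 
        (by rw [smul_mulVec, one_mulVec]), mulVec_smul, h,
      exp_mulVec_of_eigenvector hBx, smul_smul, ← Complex.exp_add]
    simp
  have hzero := mulVec_eq_zero_of_exp_mulVec (fun z hz => by
    rw [← Algebra.algebraMap_eq_smul_one, ← spectrum.add_singleton_eq] at hz
    obtain ⟨w, hw, _, rfl, rfl⟩ := Set.mem_add.1 hz
    rw [Complex.add_im, Complex.neg_im, ← sub_eq_add_neg]
    have := abs_sub w.im μ.im
    linarith [hA' w hw, hB' μ hμspec]) hexp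
  rw [add_mulVec, smul_mulVec, one_mulVec, neg_smul, ← sub_eq_add_neg, sub_eq_zero, ← hBx] at hzero
  ext i
  have := congrFun hzero i
  simpa [Matrix.toLpLin_apply] using this

lemma map_exp_ofReal (X : Mat n n) :
    (NormedSpace.exp X).map (algebraMap ℝ ℂ) = NormedSpace.exp (X.map (algebraMap ℝ ℂ)) :=
  NormedSpace.map_exp (algebraMap ℝ ℂ).mapMatrix
    (continuous_id.matrix_map Complex.continuous_ofReal) X

/-- The principal logarithm is unique if there is a skew-symmetric one. -/
lemma IsMatrixLog.eq {A X Y : Mat n n} (hY : Yᵀ = -Y) (h : IsMatrixLog A X)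
    (h' : IsMatrixLog A Y) : X = Y := by
  apply Matrix.map_injective (algebraMap ℝ ℂ).injective
  refine eq_of_exp_eq ?_ h.2 h'.2 (by rw [← map_exp_ofReal, ← map_exp_ofReal, h.1, h'.1])
  ext i j
  have := congrFun (congrFun hY i) j
  simp only [transpose_apply] at this
  simp [this]

end ComplexExp

/-! ### The rotation generating the geodesic, and the projector formula. -/

section Rotation

variable {n p : ℕ} {a W : Mat n p} {θ : Fin p → ℝ}

/-- The infinitesimal rotation which generates `geodesic a W θ`. -/
noncomputable def generator (a W : Mat n p) (θ : Fin p → ℝ) : Mat n n :=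
  W * diagonal θ * aᵀ - a * diagonal θ * Wᵀ

lemma transpose_generator : (generator a W θ)ᵀ = -generator a W θ := by
  simp [generator, Matrix.mul_assoc]

lemma diagonal_mul_transpose_mul (h : aᵀ * W * diagonal θ = 0) : diagonal θ * Wᵀ * a = 0 := by
  have := congrArg Matrix.transpose h
  simpa [Matrix.mul_assoc] using this

lemma transpose_mul_generator (ha : aᵀ * a = 1) (h : aᵀ * W * diagonal θ = 0) :
    aᵀ * generator a W θ = -(diagonal θ * Wᵀ) := by
  rw [generator, Matrix.mul_sub, ← Matrix.mul_assoc, ← Matrix.mul_assoc, h, ← Matrix.mul_assoc,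
    ← Matrix.mul_assoc, ha]
  simp

lemma diagonal_mul_generator (hW : Wᵀ * W = 1) (h : aᵀ * W * diagonal θ = 0) :
    diagonal θ * Wᵀ * generator a W θ = diagonal (fun i => θ i ^ 2) * aᵀ := by
  have h' := diagonal_mul_transpose_mul h
  rw [generator, Matrix.mul_sub, Matrix.mul_assoc a, ← Matrix.mul_assoc _ a, h', Matrix.zero_mul,
    sub_zero, Matrix.mul_assoc W, Matrix.mul_assoc (diagonal θ), ← Matrix.mul_assoc Wᵀ, hW,
    Matrix.one_mul, ← Matrix.mul_assoc, diagonal_mul_diagonal]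
  simp [sq]

lemma generator_mul_tau (ha : aᵀ * a = 1) (h : aᵀ * W * diagonal θ = 0) :
    generator a W θ * tau a = W * diagonal θ * aᵀ := by
  have h' := diagonal_mul_transpose_mul h
  rw [generator, tau, Matrix.sub_mul, ← Matrix.mul_assoc _ a, Matrix.mul_assoc _ aᵀ a, ha,
    ← Matrix.mul_assoc _ a, Matrix.mul_assoc _ Wᵀ a, Matrix.mul_assoc a,
    ← Matrix.mul_assoc _ Wᵀ, h']
  simp

lemma tau_mul_generator (ha : aᵀ * a = 1) (h : aᵀ * W * diagonal θ = 0) :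
    tau a * generator a W θ = -(a * diagonal θ * Wᵀ) := by
  rw [tau, Matrix.mul_assoc, transpose_mul_generator ha h, Matrix.mul_neg, Matrix.mul_assoc]

lemma generator_mul_geodesic (ha : aᵀ * a = 1) (hW : Wᵀ * W = 1) (h : aᵀ * W * diagonal θ = 0)
    (t : ℝ) : generator a W θ * geodesic a W θ t = geodesicVelocity a W θ t := by
  have h' := diagonal_mul_transpose_mul h
  have e : diagonal θ * Wᵀ * geodesic a W θ t = diagonal fun i => θ i * Real.sin (t * θ i) := by
    rw [geodesic, Matrix.mul_add, ← Matrix.mul_assoc, h', Matrix.zero_mul, zero_add,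
      Matrix.mul_assoc, ← Matrix.mul_assoc Wᵀ, hW, Matrix.one_mul, diagonal_mul_diagonal]
  rw [generator, Matrix.sub_mul, Matrix.mul_assoc _ aᵀ, transpose_geodesic_mul ha h,
    Matrix.mul_assoc, diagonal_mul_diagonal, Matrix.mul_assoc a, Matrix.mul_assoc a, e,
    geodesicVelocity, sub_eq_neg_add, ← Matrix.mul_neg, diagonal_neg]

/-- The geodesic solves `γ' = Ω γ`, so `exp (-t Ω) γ(t)` is constant. -/
lemma exp_generator_mul (ha : aᵀ * a = 1) (hW : Wᵀ * W = 1) (h : aᵀ * W * diagonal θ = 0) :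
    NormedSpace.exp (generator a W θ) * a = geodesic a W θ 1 := by
  set Ω := generator a W θ with hΩ
  have hd : ∀ t ∈ Icc (0 : ℝ) 1, HasDerivWithinAt
      (fun t : ℝ => NormedSpace.exp (t • (-Ω)) * geodesic a W θ t) 0 (Icc 0 1) t := fun t _ => by
    refine (hasDerivWithinAt_mul (hasDerivAt_exp_smul_const (-Ω) t).hasDerivWithinAt
      (hasDerivAt_geodesic a W θ t).hasDerivWithinAt).congr_deriv ?_
    rw [Matrix.mul_assoc, Matrix.neg_mul, hΩ, generator_mul_geodesic ha hW h]
    simp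
  have h1 := eq_of_hasDerivWithinAt_zero hd 1 (by simp)
  simp only [one_smul, zero_smul, NormedSpace.exp_zero, geodesic_zero, Matrix.one_mul] at h1
  refine (congrArg (fun M : Mat n p => NormedSpace.exp Ω * M) h1).symm.trans ?_
  rw [← Matrix.mul_assoc, ← Matrix.exp_add_of_commute _ _ ((Commute.refl Ω).neg_right)]
  simp

/-- The reflection `R = 1 - 2 tau a` anticommutes with `Ω`, so `R exp(Ω) R = exp(-Ω)`. With `E = exp
Ω`, this gives `E E = (E R Eᵀ) R`, and `E R Eᵀ` is the reflection at the end point. -/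
lemma exp_two_smul_generator (ha : aᵀ * a = 1) (hW : Wᵀ * W = 1)
    (h : aᵀ * W * diagonal θ = 0) :
    NormedSpace.exp ((2 : ℝ) • generator a W θ) =
      (1 - (2 : ℝ) • tau (geodesic a W θ 1)) * (1 - (2 : ℝ) • tau a) := by
  set Ω := generator a W θ with hΩ
  set R : Mat n n := 1 - (2 : ℝ) • tau a with hR
  set E := NormedSpace.exp Ω
  have hRR : R * R = 1 := by
    have := (tau_mem_gr (U := a) ha).2.1
    rw [hR, Matrix.sub_mul, Matrix.mul_sub, Matrix.mul_sub]
    simp only [Matrix.smul_mul, Matrix.mul_smul, this, Matrix.one_mul, Matrix.mul_one]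
    module
  have hanti : R * Ω = -Ω * R := by
    rw [hR, Matrix.sub_mul, Matrix.mul_sub, Matrix.smul_mul, Matrix.mul_smul, hΩ,
      tau_mul_generator ha h, Matrix.neg_mul, Matrix.neg_mul, generator_mul_tau ha h, generator]
    simp only [Matrix.one_mul, Matrix.mul_one]
    module
  have hET : Eᵀ = NormedSpace.exp (-Ω) := by
    rw [← Matrix.exp_transpose, transpose_generator]
  have hEE : E * Eᵀ = 1 := by
    rw [hET, ← Matrix.exp_add_of_commute _ _ ((Commute.refl Ω).neg_right)]
    simp
  have hconj : Eᵀ = R * E * R := by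
    rw [hET]
    have := Matrix.exp_units_conj ⟨R, R, hRR, hRR⟩ Ω
    simp only [Units.inv_mk] at this
    rw [hanti, Matrix.mul_assoc, hRR, Matrix.mul_one] at this
    exact this
  have hQ : 1 - (2 : ℝ) • tau (geodesic a W θ 1) = E * R * Eᵀ := by
    rw [← exp_generator_mul ha hW h, hR, Matrix.mul_sub, Matrix.sub_mul, Matrix.mul_one, hEE, tau,
      tau, transpose_mul]
    simp only [Matrix.mul_smul, Matrix.smul_mul, Matrix.mul_assoc]
    rfl
  rw [hQ, two_smul, Matrix.exp_add_of_commute _ _ (Commute.refl Ω), hconj]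
  simp only [Matrix.mul_assoc, hRR, Matrix.mul_one]
  rw [← Matrix.mul_assoc R R, hRR, Matrix.one_mul]

/-- For an eigenvector `x` of `Ω` with eigenvalue `l`, put `α = aᵀ x` and `β = diag(θ) Wᵀ x`. Then
`l α = -β` and `l β = θ² α`, so `l = ± i θᵢ` for some `i`, unless `α = β = 0`, in which case `l =
0`. -/
lemma spectrum_generator (ha : aᵀ * a = 1) (hW : Wᵀ * W = 1) (h : aᵀ * W * diagonal θ = 0)
    (hθ : ∀ i, 0 ≤ θ i ∧ θ i < Real.pi / 2) :
    ∀ z ∈ spectrum ℂ (((2 : ℝ) • generator a W θ).map (algebraMap ℝ ℂ)), |z.im| < Real.pi := by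
  intro z hz
  rw [← Matrix.spectrum_toLin', ← Module.End.hasEigenvalue_iff_mem_spectrum] at hz
  obtain ⟨x, hx, hx0⟩ := hz.exists_hasEigenvector
  rw [Module.End.mem_eigenspace_iff, Matrix.toLin'_apply] at hx
  set Ω := generator a W θ with hΩ
  let c : ℝ →+* ℂ := algebraMap ℝ ℂ
  have hx2 : Ω.map c *ᵥ x = (z / 2) • x := by
    have e : ((2 : ℝ) • Ω).map (algebraMap ℝ ℂ) = (2 : ℂ) • Ω.map c := by
      ext i j; simp [c]
    rw [e, smul_mulVec] at hx
    rw [div_eq_inv_mul, mul_smul, ← hx, smul_smul]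
    simp
  set l := z / 2 with hl
  set α := (aᵀ).map c *ᵥ x with hα
  set β := (diagonal θ * Wᵀ).map c *ᵥ x with hβ
  have e1 : l • α = -β := by
    have := congrArg (fun M => M.map c *ᵥ x) (transpose_mul_generator ha h)
    simp only [Matrix.map_mul] at this
    rw [← mulVec_mulVec, hx2, mulVec_smul] at this
    rw [this, hβ, ← neg_mulVec]
    congr 1
    ext i j; simp
  have e2 : ∀ i, l * β i = (θ i : ℂ) ^ 2 * α i := by
    have := congrArg (fun M => M.map c *ᵥ x) (diagonal_mul_generator hW h)
    simp only [Matrix.map_mul (f := c) (L := diagonal θ * Wᵀ),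
      Matrix.map_mul (f := c) (L := diagonal fun i => θ i ^ 2)] at this
    rw [← mulVec_mulVec, ← mulVec_mulVec, hx2, mulVec_smul] at this
    intro i
    have hi := congrFun this i
    rw [Matrix.diagonal_map (map_zero c), mulVec_diagonal] at hi
    simpa [c, hα, hβ] using hi
  have e3 : l • x = (W * diagonal θ).map c *ᵥ α - a.map c *ᵥ β := by
    rw [← hx2, hα, hβ, mulVec_mulVec, mulVec_mulVec, ← Matrix.map_mul, ← Matrix.map_mul,
      ← sub_mulVec, hΩ, generator, Matrix.mul_assoc a]
    congr 1
    ext i j; simp only [Matrix.map_apply, Matrix.sub_apply, map_sub]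
  have key : |l.im| < Real.pi / 2 := by
    by_cases hα0 : α = 0
    · have hβ0 : β = 0 := by rw [hα0, smul_zero] at e1; exact neg_eq_zero.1 e1.symm
      rw [hα0, hβ0, mulVec_zero, mulVec_zero, sub_zero, smul_eq_zero] at e3
      rw [e3.resolve_right hx0]
      simpa using Real.pi_pos
    · obtain ⟨i, hi⟩ := Function.ne_iff.1 hα0
      have hβi : β i = -(l * α i) := by
        have := congrFun e1 i
        simp only [Pi.smul_apply, Pi.neg_apply, smul_eq_mul] at this
        rw [this, neg_neg]
      have h4 := e2 i
      rw [hβi] at h4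
      have h5 : (l - θ i * Complex.I) * (l + θ i * Complex.I) = 0 := by
        refine (mul_eq_zero.1 (?_ : _ * α i = 0)).resolve_right hi
        linear_combination -h4 - (θ i : ℂ) ^ 2 * α i * Complex.I_sq
      have h6 : |l.im| = θ i := by
        rcases mul_eq_zero.1 h5 with h7 | h7
        · rw [sub_eq_zero.1 h7]; simp [abs_of_nonneg (hθ i).1]
        · rw [eq_neg_of_add_eq_zero_left h7]; simp [abs_of_nonneg (hθ i).1]
      rw [h6]
      exact (hθ i).2
  have hzl : z.im = 2 * l.im := by
    rw [show z = 2 * l by rw [hl]; ring]; simp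
  rw [hzl, abs_mul, abs_two]
  linarith

/-- The closed form of the logarithm in the projector perspective, at the end point of a
geodesic. -/
lemma isGrLogFormula_geodesic_iff (ha : aᵀ * a = 1) (hW : Wᵀ * W = 1)
    (h : aᵀ * W * diagonal θ = 0) (hθ : ∀ i, 0 ≤ θ i ∧ θ i < Real.pi / 2) (Δ : Mat n n) :
    IsGrLogFormula (tau a) (tau (geodesic a W θ 1)) Δ ↔
      Δ = a * (W * diagonal θ)ᵀ + W * diagonal θ * aᵀ := by
  have hlog : IsMatrixLog ((1 - (2 : ℝ) • tau (geodesic a W θ 1)) * (1 - (2 : ℝ) • tau a))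
      ((2 : ℝ) • generator a W θ) :=
    ⟨exp_two_smul_generator ha hW h, spectrum_generator ha hW h hθ⟩
  have hskew : ((2 : ℝ) • generator a W θ)ᵀ = -((2 : ℝ) • generator a W θ) := by
    rw [transpose_smul, transpose_generator, smul_neg]
  have hval : ⁅(1 / 2 : ℝ) • (2 : ℝ) • generator a W θ, tau a⁆ =
      a * (W * diagonal θ)ᵀ + W * diagonal θ * aᵀ := by
    rw [smul_smul, Ring.lie_def]
    norm_num
    rw [generator_mul_tau ha h, tau_mul_generator ha h, Matrix.mul_assoc a]
    abel
  constructor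
  · rintro ⟨X, hX, rfl⟩
    rw [hX.eq hskew hlog, hval]
  · rintro rfl
    exact ⟨_, hlog, hval.symm⟩

end Rotation

/-! ### Closed forms from a singular value decomposition. -/

section ClosedForm

variable {n p : ℕ}

/-- The closed forms of the logarithms obtained from a singular value decomposition. -/
lemma IsThinSVD.isGrLog {U V W : Mat n p} {σ : Fin p → ℝ} {Z : Mat p p} (hU : U ∈ Onb n p)
    (hV : V ∈ Onb n p) (hUV : IsUnit (Uᵀ * V))
    (h : IsThinSVD ((1 - U * Uᵀ) * V * (Uᵀ * V)⁻¹) W σ Z) {L : Mat n p}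
    (hL : L = W * diagonal (fun i => Real.arctan (σ i)) * Zᵀ) :
    Uᵀ * L = 0 ∧ IsGrLog p (tau U) (tau V) (U * Lᵀ + L * Uᵀ) ∧
      ∀ Δ, IsGrLogFormula (tau U) (tau V) Δ ↔ Δ = U * Lᵀ + L * Uᵀ := by
  obtain ⟨hW, hZ, hσ, hM⟩ := h
  set M := (1 - U * Uᵀ) * V * (Uᵀ * V)⁻¹ with hMdef
  have hU' : Uᵀ * U = 1 := hU
  have hV' : Vᵀ * V = 1 := hV
  have hZZ : Z * Zᵀ = 1 := (Matrix.mem_orthogonalGroup_iff _ _).1 hZ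
  have hZZ' : Zᵀ * Z = 1 := (Matrix.mem_orthogonalGroup_iff' _ _).1 hZ
  have hdet : IsUnit (Uᵀ * V).det := (Matrix.isUnit_iff_isUnit_det _).1 hUV
  let θ : Fin p → ℝ := fun i => Real.arctan (σ i)
  have hθ : ∀ i, 0 ≤ θ i ∧ θ i < Real.pi / 2 := fun i =>
    ⟨Real.arctan_nonneg.2 (hσ i), Real.arctan_lt_pi_div_two _⟩
  have hMZ : M * Z = W * diagonal σ := by
    rw [hM, Matrix.mul_assoc, hZZ', Matrix.mul_one]
  have hUM : Uᵀ * M = 0 := by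
    rw [hMdef, Matrix.mul_assoc (1 - U * Uᵀ)]
    exact transpose_mul_horPart hU _
  have hUW : Uᵀ * W * diagonal σ = 0 := by
    rw [Matrix.mul_assoc, ← hMZ, ← Matrix.mul_assoc, hUM, Matrix.zero_mul]
  have hUθ : Uᵀ * (W * diagonal θ) = 0 :=
    mul_diagonal_eq_zero hUW fun i hi => by simp [θ, hi]
  -- Changing the representative from `U` to `U Z` makes the principal directions the columns.
  set a := U * Z with hadef
  have ha : aᵀ * a = 1 := by
    rw [hadef, transpose_mul, Matrix.mul_assoc, ← Matrix.mul_assoc Uᵀ, hU', Matrix.one_mul, hZZ']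
  have hort : aᵀ * W * diagonal θ = 0 := by
    rw [hadef, transpose_mul, Matrix.mul_assoc, Matrix.mul_assoc, hUθ, Matrix.mul_zero]
  have hτa : tau a = tau U := (SamePoint.tau_eq ⟨Z, hZ, rfl⟩).symm
  have hUM' : U + M = V * (Uᵀ * V)⁻¹ := by
    rw [hMdef, Matrix.sub_mul, Matrix.sub_mul, Matrix.one_mul, Matrix.mul_assoc U,
      Matrix.mul_assoc U, Matrix.mul_nonsing_inv _ hdet, Matrix.mul_one, add_sub_cancel]
  -- Since `sin θ = σ cos θ`, the end point is `(U + M) Z cos θ`, and `U + M = V (Uᵀ V)⁻¹` has its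
  -- columns in the span of `V`.
  have hend : geodesic a W θ 1 =
      V * ((Uᵀ * V)⁻¹ * Z * diagonal fun i => Real.cos (1 * θ i)) := by
    have hsin : (diagonal (fun i => Real.sin (1 * θ i)) : Mat p p) =
        diagonal σ * diagonal fun i => Real.cos (1 * θ i) := by
      rw [diagonal_mul_diagonal]
      congr 1
      ext i
      rw [one_mul, Real.sin_arctan, Real.cos_arctan, mul_one_div]
    rw [geodesic, hsin, ← Matrix.mul_assoc, ← hMZ, hadef, ← Matrix.add_mul, ← Matrix.add_mul,
      hUM']
    simp only [Matrix.mul_assoc]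
  have hτV : tau (geodesic a W θ 1) = tau V := by
    refine (SamePoint.tau_eq ⟨_, mem_orthogonalGroup_of_transpose_mul ?_, hend⟩).symm
    have hg : (geodesic a W θ 1)ᵀ * geodesic a W θ 1 = 1 := geodesic_mem_onb ha hW hort 1
    rw [hend, transpose_mul, Matrix.mul_assoc, ← Matrix.mul_assoc Vᵀ, hV', Matrix.one_mul] at hg
    exact hg
  have hval : a * (W * diagonal θ)ᵀ + W * diagonal θ * aᵀ = U * Lᵀ + L * Uᵀ := by
    rw [hL, hadef]
    simp only [transpose_mul, transpose_transpose, Matrix.mul_assoc, θ]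
  refine ⟨?_, ?_, fun Δ => ?_⟩
  · rw [hL, ← Matrix.mul_assoc, hUθ, Matrix.zero_mul]
  · rw [← hval, ← hτa, ← hτV]
    exact isGrLog_geodesic ha hW hort hθ
  · rw [← hval, ← hτa, ← hτV]
    exact isGrLogFormula_geodesic_iff ha hW hort hθ Δ

end ClosedForm

end Grass

open Grass Matrix in
theorem proposition3p12 (n p : ℕ) :
    -- `tau` is a bijection from the ONB Grassmannian onto the projector Grassmannian
    (∀ U ∈ Onb n p, tau U ∈ Gr n p) ∧
    (∀ P ∈ Gr n p, ∃ U ∈ Onb n p, tau U = P) ∧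
    (∀ U ∈ Onb n p, ∀ V ∈ Onb n p, tau U = tau V ↔ SamePoint U V) ∧
    ∀ P ∈ Gr n p, ∀ Q ∈ Gr n p, ∀ U ∈ Onb n p, ∀ V ∈ Onb n p, tau U = P → tau V = Q →
      -- one logarithm is defined iff the other one is, and then they are related as claimed
      (∀ Δ : Mat n n, IsGrLog p P Q Δ ↔
        ∃ L : Mat n p, IsOnbLog U V L ∧ Δ = U * Lᵀ + L * Uᵀ) ∧
      -- if `Uᵀ V` is invertible, then they are defined and have the usual closed forms
      (IsUnit (Uᵀ * V) →
        ∃ L : Mat n p, IsOnbLog U V L ∧ IsGrLog p P Q (U * Lᵀ + L * Uᵀ) ∧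
          (∀ L' : Mat n p, IsOnbLogFormula U V L' ↔ L' = L) ∧
          (∀ Δ : Mat n n, IsGrLogFormula P Q Δ ↔ Δ = U * Lᵀ + L * Uᵀ)) := by
  refine ⟨fun U hU => tau_mem_gr hU, fun P hP => exists_tau_eq hP,
    fun U _ V hV => tau_eq_iff hV, ?_⟩
  rintro _ - _ - U hU V hV rfl rfl
  refine ⟨isGrLog_iff hU, fun hUV => ?_⟩
  obtain ⟨W, σ, Z, hsvd⟩ := exists_thinSVD (le_of_mem_onb hU) ((1 - U * Uᵀ) * V * (Uᵀ * V)⁻¹)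
  obtain ⟨hhor, hlog, hform⟩ := hsvd.isGrLog hU hV hUV rfl
  obtain ⟨L, hL, he⟩ := (isGrLog_iff hU _).1 hlog
  obtain rfl := horizontal_injective hU hhor (hL.horizontal hU) he
  refine ⟨_, hL, hlog, fun L' => ⟨?_, ?_⟩, hform⟩
  -- Every singular value decomposition yields the same logarithm, so the closed form does not
  -- depend on its choice.
  · rintro ⟨W', σ', Z', hsvd', hL'⟩
    obtain ⟨hhor', hlog', -⟩ := hsvd'.isGrLog hU hV hUV hL'
    exact horizontal_injective hU hhor' hhor (hlog'.unique hlog)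
  · rintro rfl
    exact ⟨W, σ, Z, hsvd, rfl⟩
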